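/- Let $(\mathbb B,\|\cdot\|)$ be a separable real Banach space, let $P$ be a Borel probability distribution on $\mathbb B$ with Bochner mean $\theta=\mathbb E_{W\sim P}[W]$ (so $\mathbb E_P\|W\|<\infty$), and let $\Theta\subseteq\mathbb B$ be open with $\theta\in\Theta$. Put $$\nu=\sup_{\|u\|_*\le 1}\mathbb E_P|\langle W-\theta,u\rangle|^2,\qquad V=\mathbb E_P\|W-\theta\|^2 .$$ Let $m=s+\rho$ with an integer $s=\lceil m\rceil-1\ge 0$ and $\rho\in(0,1]$, and let $f:\Theta\to\mathbb R$ be $s$ times continuously Fréchet differentiable. Write $\mathcal D^kf$ for its $k$-th Fréchet derivative ($\mathcal D^0f=f$), $\|T\|_{\mathrm S}=\sup\{|T[h_1,\dots,h_k]|:\|h_1\|=\dots=\|h_k\|=1\}$ for a bounded $k$-linear form $T$, and $$L=\|\mathcal D^sf\|_{\mathrm{Lip}_\rho(\Theta)}=\sup_{x\ne y\in\Theta}\frac{\|\mathcal D^sf(x)-\mathcal D^sf(y)\|_{\mathrm S}}{\|x-y\|^\rho}.$$ Let $n\ge\max(1,s)$, $N=2n$, let $W_1,\dots,W_{2n}$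 be i.i.d. with law $P$, and put $\mathcal S_1=(W_1,\dots,W_n)$, $\mathcal S_2=(W_{n+1},\dots,W_{2n})$. Let $\hat\theta_{\mathcal S_1}$, $\hat\theta_{\mathcal S_2}$ be measurable functions of $\mathcal S_1$ and of $\mathcal S_2$, respectively, with the same distribution as a random element $\hat\theta_n$ of $\mathbb B$. Assume that $\hat\theta_n\in\Theta$ almost surely and, if $s\ge1$, that the segment $[\theta,\hat\theta_n]$ is contained in $\Theta$ almost surely (automatic if $\Theta$ is convex). For a sample $\mathcal S=(w_1,\dots,w_n)$ and $b\in\mathbb B$ write $$T[\bar U^{(k)}_{\mathcal S}(b)]=\binom nk^{-1}\sum_{1\le j_1<\dots<j_k\le n}T[w_{j_1}-b,\dots,w_{j_k}-b],$$ and define the cross-fitted estimator by $$\widehat f_s(\mathcal S,\mathcal S')=f(\hat\theta_{\mathcal S'})+\sum_{k=1}^s\frac1{k!}\mathcal D^kf(\hat\theta_{\mathcal S'})\big[\bar U^{(k)}_{\mathcal S}(\hat\theta_{\mathcal S'})\big],\qquad \widehat f_s=\tfrac12\big(\widehat f_s(\mathcal S_1,\mathcal S_2)+\widehat f_s(\mathcal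 S_2,\mathcal S_1)\big).$$ Then, with both sides understood in $[0,\infty]$, $0\cdot\infty=0$, $0^0=\infty^0=1$, and $\mathbb E^{1/2}[X]=(\mathbb E X)^{1/2}$, $$\begin{aligned}\mathbb E^{1/2}\big[|\widehat f_s-f(\theta)|^2\big]\le{}&\sqrt2\,L\,\mathbb E^{1/2}\|\hat\theta_n-\theta\|^{2m}+\sqrt{\frac{2\nu}n}\sum_{k=1}^s\|\mathcal D^kf(\theta)\|_{\mathrm S}\Big(\sqrt{\frac Vn}\Big)^{k-1}\\&+\sqrt{\frac{2e\nu}n}\,L\,\mathbb E^{1/2}\Big[\Big(\|\hat\theta_n-\theta\|^2\vee\frac Vn\Big)^{m-1}\Big]\mathbf 1(s\ge1).\end{aligned}$$ Moreover, if $s\ge1$, then with $\bar W_N=N^{-1}\sum_{i=1}^NW_i$, $$\begin{aligned}\mathbb E^{1/2}\Big[N\big(\widehat f_s-f(\theta)-\mathcal D^1f(\theta)[\bar W_N-\theta]\big)^2\Big]\le{}&\sqrt{4n}\,L\,\mathbb E^{1/2}\|\hat\theta_n-\theta\|^{2m}+\sqrt{4\nu}\sum_{k=2}^s\|\mathcal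 D^kf(\theta)\|_{\mathrm S}\Big(\sqrt{\frac Vn}\Big)^{k-1}\\&+\sqrt{4e\nu}\,L\,\mathbb E^{1/2}\Big[\Big(\|\hat\theta_n-\theta\|^2\vee\frac Vn\Big)^{m-1}\Big].\end{aligned}$$ -/

import Mathlib

open MeasureTheory ProbabilityTheory
open scoped ENNReal Nat

noncomputable section

namespace CrossFit

variable {B : Type*} [NormedAddCommGroup B] [NormedSpace ℝ B]

/-- `E^{1/2}[X]` for a `[0,∞]`-valued random variable `X`. -/
def rootMean {Ω : Type*} [MeasurableSpace Ω] (μ : Measure Ω) (X : Ω → ℝ≥0∞) : ℝ≥0∞ :=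
  (∫⁻ ω, X ω ∂μ) ^ (1 / 2 : ℝ)

/-- Square root on `[0,∞]`. -/
def sqrtE (a : ℝ≥0∞) : ℝ≥0∞ := a ^ (1 / 2 : ℝ)

/-- The mean `θ(P) = E_{W ∼ P}[W]`, a Bochner integral. -/
def mean [MeasurableSpace B] (P : Measure B) : B := ∫ w, w ∂P

/-- Weak variance `ν(P) = sup_{‖u‖_* ≤ 1} E |⟨W - θ, u⟩|²`. -/
def weakVar [MeasurableSpace B] (P : Measure B) : ℝ≥0∞ :=
  ⨆ (u : StrongDual ℝ B) (_ : ‖u‖ ≤ 1), ∫⁻ w, ‖u (w - mean P)‖ₑ ^ 2 ∂P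

/-- Strong variance `V(P) = E ‖W - θ‖²`. -/
def strongVar [MeasurableSpace B] (P : Measure B) : ℝ≥0∞ :=
  ∫⁻ w, ‖w - mean P‖ₑ ^ 2 ∂P

/-- The Hölder seminorm `sup_{x, y ∈ U} ‖g x - g y‖ / ‖x - y‖ ^ ρ`, with values in `[0,∞]`.
For `ρ > 0` the diagonal contributes `0 / 0 = 0`. -/
def lipSeminorm {E : Type*} [NormedAddCommGroup E] (ρ : ℝ) (U : Set B) (g : B → E) : ℝ≥0∞ :=
  ⨆ (x ∈ U) (y ∈ U), ‖g x - g y‖ₑ / ‖x - y‖ₑ ^ ρ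

open Classical in
/-- `T[Ū^{(k)}(b)]`: the average of `T[w_{j₁} - b, …, w_{j_k} - b]` over all
`j₁ < ⋯ < j_k` among the `n` sample points. -/
def uStat {n k : ℕ} (w : Fin n → B) (b : B)
    (T : ContinuousMultilinearMap ℝ (fun _ : Fin k => B) ℝ) : ℝ :=
  ((n.choose k : ℕ) : ℝ)⁻¹ *
    ∑ J : Fin k → Fin n with StrictMono J, T (fun i => w (J i) - b)

/-- One-sided estimator: U-statistics computed from the sample `w`, expanded around the
pilot value `t`. -/
def oneSided {n : ℕ} (f : B → ℝ) (s : ℕ) (w : Fin n → B) (t : B) : ℝ :=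
  f t + ∑ k ∈ Finset.Icc 1 s, ((k ! : ℕ) : ℝ)⁻¹ * uStat w t (iteratedFDeriv ℝ k f t)

/-- The first half `w₁, …, w_n` of a sample of size `2n`. -/
def half₁ {n : ℕ} (w : Fin (n + n) → B) : Fin n → B := fun i => w (Fin.castAdd n i)

/-- The second half `w_{n+1}, …, w_{2n}` of a sample of size `2n`. -/
def half₂ {n : ℕ} (w : Fin (n + n) → B) : Fin n → B := fun i => w (Fin.natAdd n i)

/-- The cross-fitted estimator `f̂_s`: `T₁` is the pilot estimator applied to the first half,
`T₂` the one applied to the second half. -/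
def crossFit {n : ℕ} (f : B → ℝ) (s : ℕ) (T₁ T₂ : (Fin n → B) → B)
    (w : Fin (n + n) → B) : ℝ :=
  (1 / 2) * (oneSided f s (half₁ w) (T₂ (half₂ w)) + oneSided f s (half₂ w) (T₁ (half₁ w)))

/-- The full sample average `W̄_N`, `N = 2n`. -/
def sampleMean {N : ℕ} (w : Fin N → B) : B := (N : ℝ)⁻¹ • ∑ i, w i

end CrossFit

end

/-!
Freeze the pilot value `t`. By multilinearity and the symmetry of the derivatives, the U-statistics
centred at `t` can be recentred at the mean `θ`, which gives

  `oneSided f s w t - oneSided f s w θ = ∑ j ≤ s, (j!)⁻¹ R_j[Ū^{(j)}(θ)]`,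

where `R_j` is the remainder at `θ` of the Taylor expansion of `D^j f` to degree `s - j` at `t`; it
satisfies `‖R_j‖ ≤ L ‖t - θ‖ ^ (m - j) / (s - j)!`. Summands of U-statistics centred at the mean
are uncorrelated unless they involve the same sample points (Hoeffding), so second moments add up,
and `(k!)⁻² (n choose k)⁻¹ ≤ n⁻ᵏ` bounds the moment of degree `k` by `ν/n (V/n)^(k-1)`; the factor
`e` is `∑ (s - j)!⁻¹`. Since the halves of the sample are independent, integrating over the pilot
afterwards loses nothing. What is left is `oneSided f s w θ - f θ`, a sum of such U-statistics whose
degree-one terms average over the two halves to the derivative of `f` at `θ` along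
`W̄_N - θ`.
-/

noncomputable section

namespace CrossFit

section IteratedDerivatives

variable {E F : Type*} [NormedAddCommGroup E] [NormedSpace ℝ E] [NormedAddCommGroup F]
  [NormedSpace ℝ F] {f : E → F} {s : ℕ} {x : E}

/-- The iterated derivative of `f` at `x` along the vectors of a list, the head being the direction
of the outermost derivative. Lists spare the casts between `Fin (i + j)` and `Fin k`. -/
def listDeriv (f : E → F) (x : E) (l : List E) : F := iteratedFDeriv ℝ l.length f x l.get

theorem listDeriv_eq_iteratedFDeriv (f : E → F) (x : E) {l : List E} {k : ℕ} (hl : l.length = k) :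
    listDeriv f x l = iteratedFDeriv ℝ k f x fun i => l.get (i.cast hl.symm) := by
  subst hl
  rfl

theorem listDeriv_ofFn (f : E → F) (x : E) {k : ℕ} (v : Fin k → E) :
    listDeriv f x (List.ofFn v) = iteratedFDeriv ℝ k f x v := by
  rw [listDeriv_eq_iteratedFDeriv f x (List.length_ofFn (f := v))]
  congr 1
  ext i
  simp

theorem listDeriv_cons (hf : ContDiffAt ℝ s f x) (a : E) {l : List E} (hl : l.length < s) :
    listDeriv f x (a :: l) = fderiv ℝ (fun y => listDeriv f y l) x a :=
  (hf.differentiableAt_iteratedFDeriv (mod_cast hl)).iteratedFDeriv_succ_apply_left'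

theorem listDeriv_cons_eventuallyEq (hf : ContDiffAt ℝ s f x) (a : E) {l : List E}
    (hl : l.length < s) :
    (fun y => listDeriv f y (a :: l)) =ᶠ[nhds x]
      fun y => fderiv ℝ (fun z => listDeriv f z l) y a :=
  (hf.eventually (by simp)).mono fun _ hy => listDeriv_cons hy a hl

theorem contDiffAt_listDeriv (hf : ContDiffAt ℝ s f x) {l : List E} {j : ℕ}
    (hl : j + l.length ≤ s) : ContDiffAt ℝ j (fun y => listDeriv f y l) x :=
  (ContinuousMultilinearMap.apply ℝ (fun _ : Fin l.length => E) F l.get).contDiff.contDiffAt.comp x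
    (hf.iteratedFDeriv_right (mod_cast hl))

theorem listDeriv_cons_cons (hf : ContDiffAt ℝ s f x) (a b : E) {l : List E}
    (hl : l.length + 1 < s) :
    listDeriv f x (a :: b :: l) = fderiv ℝ (fderiv ℝ fun y => listDeriv f y l) x a b := by
  have hdiff : DifferentiableAt ℝ (fderiv ℝ fun y => listDeriv f y l) x :=
    ((contDiffAt_listDeriv (j := 2) hf (by omega)).fderiv_right (m := 1)
      (by norm_num)).differentiableAt (by simp)
  rw [listDeriv_cons hf a (l := b :: l) hl, (listDeriv_cons_eventuallyEq hf b (by omega)).fderiv_eq,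
    fderiv_clm_apply hdiff (differentiableAt_const b)]
  simp

theorem listDeriv_eq_of_perm {l l' : List E} (h : l.Perm l') :
    ∀ {x : E}, ContDiffAt ℝ s f x → l.length ≤ s → listDeriv f x l = listDeriv f x l' := by
  induction h with
  | nil => exact fun _ _ => rfl
  | @cons a l l' h ih =>
    intro x hf hl
    have hl' : l.length < s := by simpa using hl
    have hev : (fun y => listDeriv f y l) =ᶠ[nhds x] fun y => listDeriv f y l' :=
      (hf.eventually (by simp)).mono fun y hy => ih hy hl'.le
    rw [listDeriv_cons hf a hl', listDeriv_cons hf a (h.length_eq ▸ hl'), hev.fderiv_eq]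
  | swap a b l =>
    intro x hf hl
    have hl' : l.length + 1 < s := by simpa using hl
    rw [listDeriv_cons_cons hf _ _ hl', listDeriv_cons_cons hf _ _ hl']
    exact (contDiffAt_listDeriv (j := 2) hf (by omega)).isSymmSndFDerivAt (by simp) _ _
  | trans h₁ _ ih₁ ih₂ =>
    intro x hf hl
    rw [ih₁ hf hl, ih₂ hf (h₁.length_eq ▸ hl)]

theorem iteratedFDeriv_iteratedFDeriv_apply {i j : ℕ} (u : Fin i → E) (v : Fin j → E)
    (hij : i + j ≤ s) : ∀ {x : E}, ContDiffAt ℝ s f x →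
      iteratedFDeriv ℝ i (iteratedFDeriv ℝ j f) x u v =
        listDeriv f x (List.ofFn u ++ List.ofFn v) := by
  induction i with
  | zero => simp [listDeriv_ofFn]
  | succ i ih =>
    intro x hf
    have hdiff : DifferentiableAt ℝ (iteratedFDeriv ℝ i (iteratedFDeriv ℝ j f)) x :=
      (hf.iteratedFDeriv_right (m := (i + 1 : ℕ)) (mod_cast hij)).differentiableAt_iteratedFDeriv
        (mod_cast i.lt_succ_self)
    have hev : (fun y => listDeriv f y (List.ofFn (Fin.tail u) ++ List.ofFn v)) =ᶠ[nhds x]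
        fun y => iteratedFDeriv ℝ i (iteratedFDeriv ℝ j f) y (Fin.tail u) v :=
      (hf.eventually (by simp)).mono fun y hy => (ih (Fin.tail u) (by omega) hy).symm
    have hu : List.ofFn u = u 0 :: List.ofFn (Fin.tail u) := List.ofFn_succ
    rw [hu, List.cons_append, listDeriv_cons hf _ (by simp; omega), hev.fderiv_eq,
      hdiff.iteratedFDeriv_succ_apply_left',
      fderiv_continuousMultilinear_apply_const (hdiff.continuousMultilinear_apply_const _)]
    rfl

theorem norm_listDeriv_sub_le (f : E → F) (x y : E) {l : List E} {k : ℕ} (hl : l.length = k) :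
    ‖listDeriv f x l - listDeriv f y l‖ ≤
      ‖iteratedFDeriv ℝ k f x - iteratedFDeriv ℝ k f y‖ * (l.map fun v => ‖v‖).prod := by
  subst hl
  rw [← List.ofFn_getElem_eq_map, List.prod_ofFn]
  exact (iteratedFDeriv ℝ l.length f x - iteratedFDeriv ℝ l.length f y).le_opNorm l.get

theorem norm_iteratedFDeriv_iteratedFDeriv_sub_le {i j : ℕ} {y : E} (hx : ContDiffAt ℝ s f x)
    (hy : ContDiffAt ℝ s f y) (hij : i + j ≤ s) (u : Fin i → E) :
    ‖iteratedFDeriv ℝ i (iteratedFDeriv ℝ j f) x u -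
        iteratedFDeriv ℝ i (iteratedFDeriv ℝ j f) y u‖ ≤
      ‖iteratedFDeriv ℝ (i + j) f x - iteratedFDeriv ℝ (i + j) f y‖ * ∏ a, ‖u a‖ := by
  refine ContinuousMultilinearMap.opNorm_le_bound (by positivity) fun v => ?_
  rw [sub_apply, iteratedFDeriv_iteratedFDeriv_apply u v hij hx,
    iteratedFDeriv_iteratedFDeriv_apply u v hij hy]
  refine (norm_listDeriv_sub_le f x y (k := i + j) (by simp)).trans_eq ?_
  simp [List.map_ofFn, List.prod_ofFn, mul_assoc]

end IteratedDerivatives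

section MultisetDerivatives

variable {E F : Type*} [NormedAddCommGroup E] [NormedSpace ℝ E] [NormedAddCommGroup F]
  [NormedSpace ℝ F] {f : E → F} {s : ℕ} {x : E}

/-- The iterated derivative of `f` at `x` along the vectors of a multiset. By symmetry of the
derivatives the arbitrary order chosen by `Multiset.toList` is immaterial where `f` is smooth. -/
def multisetDeriv (f : E → F) (x : E) (M : Multiset E) : F := listDeriv f x M.toList

theorem multisetDeriv_coe (hf : ContDiffAt ℝ s f x) {l : List E} (hl : l.length ≤ s) :
    multisetDeriv f x l = listDeriv f x l :=
  listDeriv_eq_of_perm (Multiset.coe_eq_coe.1 (Multiset.coe_toList _)) hf (by simpa using hl)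

theorem multisetDeriv_map_univ (hf : ContDiffAt ℝ s f x) {k : ℕ} (hk : k ≤ s) (v : Fin k → E) :
    multisetDeriv f x (Finset.univ.val.map v) = iteratedFDeriv ℝ k f x v := by
  rw [Fin.univ_val_map, multisetDeriv_coe hf (by simpa using hk), listDeriv_ofFn]

theorem multisetDeriv_map_univ_add_replicate (hf : ContDiffAt ℝ s f x) {i j : ℕ} (hij : i + j ≤ s)
    (v : Fin j → E) (h : E) :
    multisetDeriv f x (Finset.univ.val.map v + Multiset.replicate i h) =
      iteratedFDeriv ℝ i (iteratedFDeriv ℝ j f) x (fun _ => h) v := by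
  rw [iteratedFDeriv_iteratedFDeriv_apply _ v hij hf,
    ← multisetDeriv_coe hf (by simpa using hij), Fin.univ_val_map, List.ofFn_const,
    ← Multiset.coe_add, Multiset.coe_replicate, add_comm]

theorem multisetDeriv_cons (hf : ContDiffAt ℝ s f x) (a : E) {M : Multiset E} (hM : M.card < s) :
    multisetDeriv f x (a ::ₘ M) = fderiv ℝ (fun y => listDeriv f y M.toList) x a := by
  rw [← listDeriv_cons hf a (by simpa using hM), ← multisetDeriv_coe hf (by simpa using hM),
    ← Multiset.cons_coe, Multiset.coe_toList]

theorem multisetDeriv_add_cons (hf : ContDiffAt ℝ s f x) (a b : E) {M : Multiset E}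
    (hM : M.card < s) :
    multisetDeriv f x ((a + b) ::ₘ M) =
      multisetDeriv f x (a ::ₘ M) + multisetDeriv f x (b ::ₘ M) := by
  simp only [multisetDeriv_cons hf _ hM, map_add]

theorem multisetDeriv_map_add {ι : Type*} (hf : ContDiffAt ℝ s f x) (a : ι → E)
    (b : E) (A : Finset ι) (N : Multiset E) (hA : A.card + N.card ≤ s) :
    multisetDeriv f x (A.val.map (fun i => a i + b) + N) =
      ∑ R ∈ A.powerset,
        multisetDeriv f x (R.val.map a + Multiset.replicate (A.card - R.card) b + N) := by
  classical
  induction A using Finset.induction_on generalizing N with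
  | empty => simp
  | @insert i A hi ih =>
    rw [Finset.card_insert_of_notMem hi] at hA
    rw [Finset.sum_powerset_insert hi, Finset.insert_val_of_notMem hi, Multiset.map_cons,
      Multiset.cons_add, multisetDeriv_add_cons hf _ _ (by simp; omega), ← Multiset.add_cons,
      ← Multiset.add_cons, ih _ (by simp; omega), ih _ (by simp; omega), add_comm]
    congr 1 <;> refine Finset.sum_congr rfl fun R hR => ?_
    · have hRA := Finset.card_le_card (Finset.mem_powerset.1 hR)
      rw [Finset.card_insert_of_notMem hi, Nat.sub_add_comm hRA, Multiset.replicate_succ,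
        Multiset.add_cons, Multiset.add_cons, Multiset.cons_add]
    · have hiR : i ∉ R := fun h => hi (Finset.mem_powerset.1 hR h)
      rw [Finset.card_insert_of_notMem hi, Finset.card_insert_of_notMem hiR,
        Finset.insert_val_of_notMem hiR, Nat.add_sub_add_right, Multiset.map_cons,
        Multiset.cons_add, Multiset.cons_add, Multiset.add_cons]

end MultisetDerivatives

section Taylor

variable {E F : Type*} [NormedAddCommGroup E] [NormedSpace ℝ E] [NormedAddCommGroup F]
  [NormedSpace ℝ F]

/-- The Taylor polynomial of `g` of degree `r` at `t`, evaluated at `x`. -/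
def taylorPoly (g : E → F) (r : ℕ) (t x : E) : F :=
  ∑ i ∈ Finset.range (r + 1), (i ! : ℝ)⁻¹ • iteratedFDeriv ℝ i g t fun _ => x - t

theorem integral_one_sub_pow (r : ℕ) : ∫ τ in (0 : ℝ)..1, (1 - τ) ^ r = ((r : ℝ) + 1)⁻¹ := by
  rw [intervalIntegral.integral_comp_sub_left (fun τ => τ ^ r) 1]
  simp

theorem integral_one_sub_pow_smul_sub [CompleteSpace F] {D : ℝ → F}
    (hD : ContinuousOn D (Set.Icc 0 1)) (c : F) (r : ℕ) :
    ∫ τ in (0 : ℝ)..1, (1 - τ) ^ r • (D τ - c) =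
      (∫ τ in (0 : ℝ)..1, (1 - τ) ^ r • D τ) - ((r : ℝ) + 1)⁻¹ • c := by
  rw [← Set.uIcc_of_le zero_le_one] at hD
  simp only [smul_sub]
  rw [intervalIntegral.integral_sub, intervalIntegral.integral_smul_const, integral_one_sub_pow]
  all_goals exact ContinuousOn.intervalIntegrable (by fun_prop)

theorem sub_taylorPoly_eq_integral [CompleteSpace F] {g : E → F} {r : ℕ} {t x : E}
    (hg : ∀ τ ∈ Set.Icc (0 : ℝ) 1, ContDiffAt ℝ (r + 1) g (t + τ • (x - t))) :
    g x - taylorPoly g (r + 1) t x = (r ! : ℝ)⁻¹ • ∫ τ in (0 : ℝ)..1, (1 - τ) ^ r •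
      ((iteratedFDeriv ℝ (r + 1) g (t + τ • (x - t)) fun _ => x - t) -
        iteratedFDeriv ℝ (r + 1) g t fun _ => x - t) := by
  have hcont : ContinuousOn
      (fun τ : ℝ => iteratedFDeriv ℝ (r + 1) g (t + τ • (x - t)) fun _ => x - t)
      (Set.Icc 0 1) := by
    intro τ hτ
    have hderiv : ContinuousAt (iteratedFDeriv ℝ (r + 1) g) (t + τ • (x - t)) :=
      ((hg τ hτ).iteratedFDeriv_right (m := 0) (by simp)).continuousAt
    exact ((continuous_eval_const _).continuousAt.comp
      (hderiv.comp (f := fun τ : ℝ => t + τ • (x - t)) (by fun_prop))).continuousWithinAt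
  have htaylor := map_add_eq_sum_add_integral_iteratedFDeriv (x := t) (y := x - t) hg
  rw [add_sub_cancel] at htaylor
  rw [integral_one_sub_pow_smul_sub hcont, smul_sub, htaylor, taylorPoly,
    Finset.sum_range_succ _ (r + 1), smul_smul, Nat.factorial_succ]
  push_cast
  rw [mul_inv_rev]
  abel

theorem norm_sub_taylorPoly_le [CompleteSpace F] {g : E → F} {r : ℕ} {t x : E} {C : ℝ}
    (hg : ∀ τ ∈ Set.Icc (0 : ℝ) 1, ContDiffAt ℝ r g (t + τ • (x - t)))
    (hC : ∀ τ ∈ Set.Icc (0 : ℝ) 1,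
      ‖(iteratedFDeriv ℝ r g (t + τ • (x - t)) fun _ => x - t) -
        iteratedFDeriv ℝ r g t fun _ => x - t‖ ≤ C) :
    ‖g x - taylorPoly g r t x‖ ≤ (r ! : ℝ)⁻¹ * C := by
  cases r with
  | zero => simpa [taylorPoly] using hC 1 (by simp)
  | succ r =>
    rw [sub_taylorPoly_eq_integral (mod_cast hg), norm_smul, norm_inv, Real.norm_natCast]
    have hint : ‖∫ τ in (0 : ℝ)..1, (1 - τ) ^ r •
        ((iteratedFDeriv ℝ (r + 1) g (t + τ • (x - t)) fun _ => x - t) -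
          iteratedFDeriv ℝ (r + 1) g t fun _ => x - t)‖ ≤ ∫ τ in (0 : ℝ)..1, (1 - τ) ^ r * C := by
      refine intervalIntegral.norm_integral_le_of_norm_le zero_le_one
        (Filter.Eventually.of_forall fun τ hτ => ?_)
        (Continuous.intervalIntegrable (by fun_prop) _ _)
      rw [norm_smul, Real.norm_of_nonneg (pow_nonneg (by linarith [hτ.2]) _)]
      have := hτ.2
      gcongr
      exact hC τ ⟨hτ.1.le, hτ.2⟩
    rw [intervalIntegral.integral_mul_const, integral_one_sub_pow] at hint
    refine (mul_le_mul_of_nonneg_left hint (by positivity)).trans_eq ?_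
    rw [Nat.factorial_succ]
    push_cast
    rw [mul_inv]
    ring

end Taylor

section HolderRemainder

theorem enorm_sub_le_lipSeminorm {B E : Type*} [NormedAddCommGroup B] [NormedAddCommGroup E]
    {Θ : Set B} {ρ : ℝ} (hρ : 0 < ρ) (g : B → E) {x y : B} (hx : x ∈ Θ) (hy : y ∈ Θ) :
    ‖g x - g y‖ₑ ≤ lipSeminorm ρ Θ g * ‖x - y‖ₑ ^ ρ := by
  rcases eq_or_ne x y with rfl | hxy
  · simp
  have hne : ‖x - y‖ₑ ≠ 0 := by simpa [sub_eq_zero] using hxy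
  rw [← ENNReal.div_le_iff (by simp [hne]) (ENNReal.rpow_ne_top_of_nonneg hρ.le (by simp))]
  exact le_iSup₂_of_le x hx (le_iSup₂_of_le y hy le_rfl)

variable {B : Type*} [NormedAddCommGroup B] [NormedSpace ℝ B] {Θ : Set B} {s : ℕ} {ρ : ℝ}

theorem enorm_iteratedFDeriv_iteratedFDeriv_sub_le {F : Type*} [NormedAddCommGroup F]
    [NormedSpace ℝ F] {f : B → F} (hΘ : IsOpen Θ) (hf : ContDiffOn ℝ s f Θ) (hρ : 0 < ρ)
    {x y : B} (hx : x ∈ Θ) (hy : y ∈ Θ) {i j : ℕ} (hij : i + j = s) (h : B) :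
    ‖(iteratedFDeriv ℝ i (iteratedFDeriv ℝ j f) x fun _ => h) -
        iteratedFDeriv ℝ i (iteratedFDeriv ℝ j f) y fun _ => h‖ₑ ≤
      lipSeminorm ρ Θ (iteratedFDeriv ℝ s f) * ‖x - y‖ₑ ^ ρ * ‖h‖ₑ ^ i := by
  subst hij
  have hdiff : ∀ {z}, z ∈ Θ → ContDiffAt ℝ (i + j : ℕ) f z := fun hz =>
    hf.contDiffAt (hΘ.mem_nhds hz)
  have hnorm := ENNReal.ofReal_le_ofReal
    (norm_iteratedFDeriv_iteratedFDeriv_sub_le (hdiff hx) (hdiff hy) le_rfl fun _ : Fin i => h)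
  rw [ENNReal.ofReal_mul (norm_nonneg _), Fin.prod_const, ENNReal.ofReal_pow (norm_nonneg _),
    ofReal_norm, ofReal_norm, ofReal_norm] at hnorm
  exact hnorm.trans (mul_le_mul_left (enorm_sub_le_lipSeminorm hρ _ hx hy) _)

theorem enorm_taylorPoly_sub_iteratedFDeriv_le {F : Type*} [NormedAddCommGroup F]
    [NormedSpace ℝ F] [CompleteSpace F] {f : B → F} (hΘ : IsOpen Θ) (hf : ContDiffOn ℝ s f Θ)
    (hρ : 0 < ρ) {t x : B} (ht : t ∈ Θ) (hx : x ∈ Θ) (hseg : 1 ≤ s → segment ℝ x t ⊆ Θ) {j : ℕ}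
    (hj : j ≤ s) :
    ‖taylorPoly (iteratedFDeriv ℝ j f) (s - j) t x - iteratedFDeriv ℝ j f x‖ₑ ≤
      ((s - j)! : ℝ≥0∞)⁻¹ * (lipSeminorm ρ Θ (iteratedFDeriv ℝ s f) *
        ‖t - x‖ₑ ^ (((s - j : ℕ) : ℝ) + ρ)) := by
  set L := lipSeminorm ρ Θ (iteratedFDeriv ℝ s f)
  rw [enorm_sub_rev, enorm_sub_rev t x]
  rcases hj.eq_or_lt with rfl | hj
  · simpa [taylorPoly] using enorm_sub_le_lipSeminorm hρ (iteratedFDeriv ℝ j f) hx ht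
  obtain ⟨r, hr⟩ : ∃ r, r = s - j := ⟨_, rfl⟩
  rw [← hr, ENNReal.rpow_add_of_nonneg _ _ (by positivity) hρ.le, ENNReal.rpow_natCast,
    mul_comm (_ ^ r), ← mul_assoc L]
  set C := L * ‖x - t‖ₑ ^ ρ * ‖x - t‖ₑ ^ r with hC
  rcases eq_or_ne C ∞ with htop | hfin
  · rw [htop, ENNReal.mul_top (by simp)]
    exact le_top
  have hline : ∀ τ ∈ Set.Icc (0 : ℝ) 1, t + τ • (x - t) ∈ Θ := fun τ hτ =>
    hseg (by omega) (segment_symm ℝ t x ▸ segment_eq_image' ℝ t x ▸ Set.mem_image_of_mem _ hτ)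
  have hosc : ∀ τ ∈ Set.Icc (0 : ℝ) 1,
      ‖(iteratedFDeriv ℝ r (iteratedFDeriv ℝ j f) (t + τ • (x - t)) fun _ => x - t) -
        iteratedFDeriv ℝ r (iteratedFDeriv ℝ j f) t fun _ => x - t‖ ≤ C.toReal := by
    intro τ hτ
    rw [← toReal_enorm]
    refine ENNReal.toReal_mono hfin ((enorm_iteratedFDeriv_iteratedFDeriv_sub_le hΘ hf hρ
      (hline τ hτ) ht (by omega) _).trans ?_)
    rw [add_sub_cancel_left, enorm_smul, Real.enorm_eq_ofReal hτ.1, hC]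
    gcongr
    exact mul_le_of_le_one_left' (ENNReal.ofReal_le_one.2 hτ.2)
  have htaylor := norm_sub_taylorPoly_le (fun τ hτ => (hf.contDiffAt
    (hΘ.mem_nhds (hline τ hτ))).iteratedFDeriv_right (by exact_mod_cast (by omega))) hosc
  rw [← ofReal_norm]
  refine (ENNReal.ofReal_le_ofReal htaylor).trans_eq ?_
  rw [ENNReal.ofReal_mul (by positivity), ENNReal.ofReal_toReal hfin,
    ENNReal.ofReal_inv_of_pos (by positivity), ENNReal.ofReal_natCast]

end HolderRemainder

section UStatisticExpansion

theorem sum_strictMono_eq_sum_powersetCard {M : Type*} [AddCommMonoid M] {n k : ℕ}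
    (G : Finset (Fin n) → M) [DecidablePred fun J : Fin k → Fin n => StrictMono J] :
    ∑ J : Fin k → Fin n with StrictMono J, G (Finset.univ.image J) =
      ∑ A ∈ Finset.powersetCard k Finset.univ, G A := by
  refine Finset.sum_bij' (fun J _ => Finset.univ.image J)
    (fun A hA => A.orderEmbOfFin (Finset.mem_powersetCard.1 hA).2) ?_ ?_ ?_ ?_ fun _ _ => rfl
  · intro J hJ
    exact Finset.mem_powersetCard.2 ⟨Finset.subset_univ _, by
      simp [Finset.card_image_of_injective _ (Finset.mem_filter.1 hJ).2.injective]⟩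
  · intro A hA
    simpa using (A.orderEmbOfFin _).strictMono
  · intro J hJ
    exact (Finset.orderEmbOfFin_unique _ (by simp) (Finset.mem_filter.1 hJ).2).symm
  · intro A hA
    exact Finset.image_orderEmbOfFin_univ A _

theorem sum_powersetCard_sum_powersetCard {α M : Type*} [AddCommMonoid M]
    (S : Finset α) {j k : ℕ} (hjk : j ≤ k) (G : Finset α → M) :
    ∑ A ∈ S.powersetCard k, ∑ R ∈ A.powersetCard j, G R =
      ∑ R ∈ S.powersetCard j, (S.card - j).choose (k - j) • G R := by
  classical
  rw [Finset.sum_comm' (t' := S.powersetCard j)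
    (s' := fun R => (S.powersetCard k).filter fun A => R ⊆ A)]
  · refine Finset.sum_congr rfl fun R hR => ?_
    obtain ⟨hRS, hRcard⟩ := Finset.mem_powersetCard.1 hR
    rw [Finset.sum_const, Finset.card_filter_powersetCard_subset _ _ _ hRS (hRcard ▸ hjk), hRcard]
  · intro A R
    simp only [Finset.mem_powersetCard, Finset.mem_filter]
    exact ⟨fun h => ⟨⟨h.1, h.2.1⟩, h.2.1.trans h.1.1, h.2.2⟩, fun h => ⟨h.1.1, h.1.2, h.2.2⟩⟩

variable {B : Type*} [NormedAddCommGroup B] [NormedSpace ℝ B] {n : ℕ}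

theorem uStat_eq_sum_powersetCard {k : ℕ} {T : ContinuousMultilinearMap ℝ (fun _ : Fin k => B) ℝ}
    {Ψ : Multiset B → ℝ} (hT : ∀ v, T v = Ψ (Finset.univ.val.map v)) (w : Fin n → B) (b : B) :
    uStat w b T = (n.choose k : ℝ)⁻¹ *
      ∑ A ∈ Finset.powersetCard k Finset.univ, Ψ (A.val.map fun i => w i - b) := by
  classical
  rw [← sum_strictMono_eq_sum_powersetCard fun A => Ψ (A.val.map fun i => w i - b), uStat]
  congr 1
  refine Finset.sum_congr (by congr) fun J hJ => ?_
  rw [hT, Finset.image_val_of_injOn (Finset.mem_filter.1 hJ).2.injective.injOn, Multiset.map_map]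
  rfl

theorem isLinearMap_uStat {k : ℕ} (w : Fin n → B) (b : B) :
    IsLinearMap ℝ (uStat (k := k) w b) where
  map_add T T' := by simp only [uStat, add_apply, Finset.sum_add_distrib, mul_add]
  map_smul c T := by
    simp only [uStat, smul_apply, smul_eq_mul, ← Finset.mul_sum, mul_left_comm]

theorem uStat_zero (w : Fin n → B) (b : B)
    (T : ContinuousMultilinearMap ℝ (fun _ : Fin 0 => B) ℝ) : uStat w b T = T 0 := by
  have hmono : ∀ J : Fin 0 → Fin n, StrictMono J := fun _ => Subsingleton.strictMono _
  rw [uStat, Finset.filter_true_of_mem fun J _ => hmono J, Fintype.sum_unique,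
    Nat.choose_zero_right, Nat.cast_one, inv_one, one_mul]
  exact congrArg T (Subsingleton.elim _ _)

theorem inv_choose_mul_choose_sub {j k : ℕ} (hjk : j ≤ k) (hkn : k ≤ n) :
    (n.choose k : ℝ)⁻¹ * (n - j).choose (k - j) = k.choose j * (n.choose j : ℝ)⁻¹ := by
  have hchoose : (n.choose k : ℝ) * k.choose j = n.choose j * (n - j).choose (k - j) :=
    mod_cast Nat.choose_mul hjk
  have hk : (n.choose k : ℝ) ≠ 0 := mod_cast (Nat.choose_pos hkn).ne'
  have hj : (n.choose j : ℝ) ≠ 0 := mod_cast (Nat.choose_pos (hjk.trans hkn)).ne'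
  field_simp
  linear_combination -hchoose

variable {f : B → ℝ} {s : ℕ} {t : B}

theorem uStat_iteratedFDeriv_eq_sum (hf : ContDiffAt ℝ s f t) {k : ℕ} (hks : k ≤ s) (hkn : k ≤ n)
    (w : Fin n → B) (b c : B) :
    uStat w b (iteratedFDeriv ℝ k f t) = ∑ j ∈ Finset.range (k + 1), (k.choose j : ℝ) *
      uStat w c (iteratedFDeriv ℝ (k - j) (iteratedFDeriv ℝ j f) t fun _ => c - b) := by
  let G : ℕ → Finset (Fin n) → ℝ := fun j R => multisetDeriv f t
    (R.val.map (fun i => w i - c) + Multiset.replicate (k - j) (c - b))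
  have hexpand : ∀ A ∈ Finset.powersetCard k (Finset.univ : Finset (Fin n)),
      multisetDeriv f t (A.val.map fun i => w i - b) =
        ∑ j ∈ Finset.range (k + 1), ∑ R ∈ A.powersetCard j, G j R := by
    intro A hA
    obtain ⟨-, hcard⟩ := Finset.mem_powersetCard.1 hA
    have hadd := multisetDeriv_map_add hf (fun i => w i - c) (c - b) A 0 (by simp; omega)
    simp only [sub_add_sub_cancel, add_zero, hcard, Finset.sum_powerset] at hadd
    rw [hadd]
    exact Finset.sum_congr rfl fun j _ => Finset.sum_congr rfl fun R hR => by
      rw [(Finset.mem_powersetCard.1 hR).2]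
  rw [uStat_eq_sum_powersetCard fun v => (multisetDeriv_map_univ hf hks v).symm,
    Finset.sum_congr rfl hexpand, Finset.sum_comm, Finset.mul_sum]
  refine Finset.sum_congr rfl fun j hj => ?_
  have hjk : j ≤ k := Nat.lt_succ_iff.1 (Finset.mem_range.1 hj)
  rw [sum_powersetCard_sum_powersetCard _ hjk, Finset.card_univ, Fintype.card_fin,
    ← Finset.smul_sum, nsmul_eq_mul, ← mul_assoc, inv_choose_mul_choose_sub hjk hkn, mul_assoc,
    uStat_eq_sum_powersetCard
      (Ψ := fun M => multisetDeriv f t (M + Multiset.replicate (k - j) (c - b))) fun v =>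
        (multisetDeriv_map_univ_add_replicate (i := k - j) hf (by omega) v (c - b)).symm]

theorem oneSided_eq_sum_range (f : B → ℝ) (s : ℕ) (w : Fin n → B) (t : B) :
    oneSided f s w t =
      ∑ k ∈ Finset.range (s + 1), (k ! : ℝ)⁻¹ * uStat w t (iteratedFDeriv ℝ k f t) := by
  rw [oneSided, Finset.range_eq_Ico, Finset.sum_eq_sum_Ico_succ_bot s.succ_pos, uStat_zero,
    iteratedFDeriv_zero_apply, Nat.factorial_zero, Nat.cast_one, inv_one, one_mul]
  rfl

theorem uStat_taylorPoly {k r : ℕ} (w : Fin n → B) (x : B)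
    (g : B → ContinuousMultilinearMap ℝ (fun _ : Fin k => B) ℝ) :
    uStat w x (taylorPoly g r t x) = ∑ i ∈ Finset.range (r + 1), (i ! : ℝ)⁻¹ *
      uStat w x (iteratedFDeriv ℝ i g t fun _ => x - t) := by
  change (isLinearMap_uStat w x).mk' _ _ = _
  rw [taylorPoly, map_sum]
  exact Finset.sum_congr rfl fun i _ => (isLinearMap_uStat w x).map_smul _ _

theorem oneSided_eq_sum_uStat_taylorPoly (hf : ContDiffAt ℝ s f t) (hsn : s ≤ n) (w : Fin n → B)
    (x : B) :
    oneSided f s w t = ∑ j ∈ Finset.range (s + 1),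
      (j ! : ℝ)⁻¹ * uStat w x (taylorPoly (iteratedFDeriv ℝ j f) (s - j) t x) := by
  calc oneSided f s w t
      = ∑ k ∈ Finset.range (s + 1), ∑ j ∈ Finset.range (k + 1), (j ! : ℝ)⁻¹ * (((k - j)! : ℝ)⁻¹ *
          uStat w x (iteratedFDeriv ℝ (k - j) (iteratedFDeriv ℝ j f) t fun _ => x - t)) := by
        rw [oneSided_eq_sum_range]
        refine Finset.sum_congr rfl fun k hk => ?_
        have hks : k ≤ s := Nat.lt_succ_iff.1 (Finset.mem_range.1 hk)
        rw [uStat_iteratedFDeriv_eq_sum hf hks (hks.trans hsn) w t x, Finset.mul_sum]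
        refine Finset.sum_congr rfl fun j hj => ?_
        rw [Nat.cast_choose ℝ (Nat.lt_succ_iff.1 (Finset.mem_range.1 hj))]
        field_simp
    _ = _ := by
        rw [Finset.sum_range_diag_flip (s + 1) fun j i => (j ! : ℝ)⁻¹ * ((i ! : ℝ)⁻¹ *
          uStat w x (iteratedFDeriv ℝ i (iteratedFDeriv ℝ j f) t fun _ => x - t))]
        refine Finset.sum_congr rfl fun j hj => ?_
        rw [uStat_taylorPoly, Finset.mul_sum,
          Nat.sub_add_comm (Nat.lt_succ_iff.1 (Finset.mem_range.1 hj))]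

theorem oneSided_sub_oneSided {x : B} (hf : ContDiffAt ℝ s f t) (hsn : s ≤ n) (w : Fin n → B) :
    oneSided f s w t - oneSided f s w x = ∑ j ∈ Finset.range (s + 1), (j ! : ℝ)⁻¹ *
      uStat w x (taylorPoly (iteratedFDeriv ℝ j f) (s - j) t x - iteratedFDeriv ℝ j f x) := by
  simp only [oneSided_eq_sum_uStat_taylorPoly hf hsn w x, oneSided_eq_sum_range f s w x,
    ← Finset.sum_sub_distrib, ← mul_sub, (isLinearMap_uStat w x).map_sub]

end UStatisticExpansion

section Resampling

variable {ι : Type*} [Fintype ι] {E : ι → Type*} [∀ i, MeasurableSpace (E i)]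
  (P : ∀ i, Measure (E i)) [∀ i, IsProbabilityMeasure (P i)]

theorem measurePreserving_pi_comp_of_injective {α : Type*} [Fintype α] {J : α → ι}
    (hJ : Function.Injective J) :
    MeasurePreserving (fun (x : ∀ i, E i) a => x (J a)) (Measure.pi P)
      (Measure.pi fun a => P (J a)) := by
  refine ⟨by fun_prop, ?_⟩
  rw [← Measure.infinitePi_eq_pi, ← Measure.infinitePi_eq_pi]
  exact Measure.map_infinitePi_infinitePi_of_inj hJ

theorem lintegral_pi_prod {g : ∀ i, E i → ℝ≥0∞} (hg : ∀ i, Measurable (g i)) (S : Finset ι) :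
    ∫⁻ x, ∏ i ∈ S, g i (x i) ∂Measure.pi P = ∏ i ∈ S, ∫⁻ y, g i y ∂P i := by
  rw [lintegral_prod_eq_prod_lintegral_of_indepFun S (fun i (x : ∀ i, E i) => g i (x i))
    (iIndepFun_pi fun i => (hg i).aemeasurable) fun i => (hg i).comp (measurable_pi_apply i)]
  exact Finset.prod_congr rfl fun i _ => (measurePreserving_eval P i).lintegral_comp (hg i)

variable [DecidableEq ι]

theorem measurePreserving_update (i : ι) :
    MeasurePreserving (fun p : (∀ i, E i) × E i => Function.update p.1 i p.2)
      ((Measure.pi P).prod (P i)) (Measure.pi P) := by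
  refine ⟨measurable_update', (Measure.pi_eq fun S hS => ?_).symm⟩
  rw [Measure.map_apply measurable_update' (MeasurableSet.univ_pi hS)]
  have hpreimage : (fun p : (∀ i, E i) × E i => Function.update p.1 i p.2) ⁻¹' Set.univ.pi S =
      Set.univ.pi (Function.update S i Set.univ) ×ˢ S i := by
    ext ⟨x, y⟩
    simp only [Set.mem_preimage, Set.mem_univ_pi, Set.mem_prod]
    rw [Function.forall_update_iff x fun j z => z ∈ S j,
      Function.forall_update_iff S fun j A => x j ∈ A]
    simp [and_comm]
  rw [hpreimage, Measure.prod_prod, Measure.pi_pi, ← Finset.mul_prod_erase _ _ (Finset.mem_univ i),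
    ← Finset.mul_prod_erase _ _ (Finset.mem_univ i), Function.update_self, measure_univ, one_mul,
    mul_comm]
  congr 1
  exact Finset.prod_congr rfl fun j hj => by rw [Function.update_of_ne (Finset.ne_of_mem_erase hj)]

theorem lintegral_pi_eq_lintegral_lintegral_update (i : ι) {F : (∀ i, E i) → ℝ≥0∞}
    (hF : Measurable F) :
    ∫⁻ x, F x ∂Measure.pi P = ∫⁻ x, ∫⁻ y, F (Function.update x i y) ∂P i ∂Measure.pi P := by
  rw [← (measurePreserving_update P i).lintegral_comp hF]
  exact lintegral_prod _ (hF.comp measurable_update').aemeasurable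

theorem integral_pi_eq_integral_integral_update (i : ι) {F : (∀ i, E i) → ℝ}
    (hF : Integrable F (Measure.pi P)) :
    ∫ x, F x ∂Measure.pi P = ∫ x, ∫ y, F (Function.update x i y) ∂P i ∂Measure.pi P := by
  have hmap := measurePreserving_update P i
  calc ∫ x, F x ∂Measure.pi P
      = ∫ p, F (Function.update p.1 i p.2) ∂(Measure.pi P).prod (P i) := by
        rw [← integral_map hmap.aemeasurable (hmap.map_eq.symm ▸ hF.aestronglyMeasurable),
          hmap.map_eq]
    _ = _ := integral_prod _ (hmap.integrable_comp_of_integrable hF)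

end Resampling

section Orthogonality

theorem lintegral_enorm_sq_eq_ofReal_integral {Ω : Type*} [MeasurableSpace Ω] {μ : Measure Ω}
    {Z : Ω → ℝ} (hZ : MemLp Z 2 μ) :
    ∫⁻ x, ‖Z x‖ₑ ^ 2 ∂μ = ENNReal.ofReal (∫ x, Z x * Z x ∂μ) := by
  have hint : Integrable (fun x => Z x * Z x) μ := hZ.integrable_mul hZ
  rw [ofReal_integral_eq_lintegral_ofReal hint (.of_forall fun x => mul_self_nonneg _)]
  refine lintegral_congr fun x => ?_
  rw [← sq, ← sq_abs, ENNReal.ofReal_pow (abs_nonneg _), ← Real.norm_eq_abs, ofReal_norm]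

theorem lintegral_enorm_sum_sq_eq_sum {Ω κ : Type*} [MeasurableSpace Ω] {μ : Measure Ω}
    {S : Finset κ} {Y : κ → Ω → ℝ} (hY : ∀ a ∈ S, MemLp (Y a) 2 μ)
    (horth : ∀ a ∈ S, ∀ b ∈ S, a ≠ b → ∫ x, Y a x * Y b x ∂μ = 0) :
    ∫⁻ x, ‖∑ a ∈ S, Y a x‖ₑ ^ 2 ∂μ = ∑ a ∈ S, ∫⁻ x, ‖Y a x‖ₑ ^ 2 ∂μ := by
  have hint : ∀ a ∈ S, ∀ b ∈ S, Integrable (fun x => Y a x * Y b x) μ :=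
    fun a ha b hb => (hY a ha).integrable_mul (hY b hb)
  rw [lintegral_enorm_sq_eq_ofReal_integral (memLp_finsetSum S hY),
    Finset.sum_congr rfl fun a ha => lintegral_enorm_sq_eq_ofReal_integral (hY a ha),
    ← ENNReal.ofReal_sum_of_nonneg fun a _ => integral_nonneg fun x => mul_self_nonneg _]
  simp_rw [Finset.sum_mul_sum]
  rw [integral_finsetSum _ fun a ha => integrable_finsetSum _ fun b hb => hint a ha b hb]
  congr 1
  refine Finset.sum_congr rfl fun a ha => ?_
  rw [integral_finsetSum _ fun b hb => hint a ha b hb]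
  exact Finset.sum_eq_single_of_mem a ha fun b hb hne => horth a ha b hb hne.symm

variable {ι : Type*} [Fintype ι] [DecidableEq ι] {E : ι → Type*} [∀ i, MeasurableSpace (E i)]
  (P : ∀ i, Measure (E i)) [∀ i, IsProbabilityMeasure (P i)]

theorem integral_mul_eq_zero_of_degenerate {i : ι} {A : Set ι} {Y Z : (∀ i, E i) → ℝ}
    (hYZ : Integrable (fun x => Y x * Z x) (Measure.pi P))
    (hY : ∀ x, ∫ y, Y (Function.update x i y) ∂P i = 0) (hZ : DependsOn Z A) (hi : i ∉ A) :
    ∫ x, Y x * Z x ∂Measure.pi P = 0 := by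
  have hfree : ∀ x y, Z (Function.update x i y) = Z x := fun x y =>
    hZ fun j hj => Function.update_of_ne (ne_of_mem_of_not_mem hj hi) _ _
  simp only [integral_pi_eq_integral_integral_update P i hYZ, hfree, integral_mul_const, hY,
    zero_mul, integral_zero]

theorem lintegral_enorm_sum_sq_le_of_degenerate {κ : Type*} {S : Finset κ} {A : κ → Finset ι}
    (hA : Set.InjOn A S) {Y : κ → (∀ i, E i) → ℝ} (hmeas : ∀ a ∈ S, Measurable (Y a))
    (hdep : ∀ a ∈ S, DependsOn (Y a) (A a))
    (hdeg : ∀ a ∈ S, ∀ i ∈ A a, ∀ x, ∫ y, Y a (Function.update x i y) ∂P i = 0) :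
    ∫⁻ x, ‖∑ a ∈ S, Y a x‖ₑ ^ 2 ∂Measure.pi P ≤
      ∑ a ∈ S, ∫⁻ x, ‖Y a x‖ₑ ^ 2 ∂Measure.pi P := by
  by_cases htop : ∃ a ∈ S, ∫⁻ x, ‖Y a x‖ₑ ^ 2 ∂Measure.pi P = ∞
  · exact le_top.trans_eq (ENNReal.sum_eq_top.2 htop).symm
  push Not at htop
  have hL2 : ∀ a ∈ S, MemLp (Y a) 2 (Measure.pi P) := by
    intro a ha
    refine ⟨(hmeas a ha).aestronglyMeasurable, ?_⟩
    rw [eLpNorm_lt_top_iff_lintegral_rpow_enorm_lt_top two_ne_zero ENNReal.ofNat_ne_top]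
    simpa using (htop a ha).lt_top
  refine (lintegral_enorm_sum_sq_eq_sum hL2 fun a ha b hb hne => ?_).le
  have hint : Integrable (fun x => Y a x * Y b x) (Measure.pi P) :=
    (hL2 a ha).integrable_mul (hL2 b hb)
  by_cases hsub : A a ⊆ A b
  · obtain ⟨i, hib, hia⟩ := Finset.not_subset.1 fun h => hne (hA ha hb (hsub.antisymm h))
    simp_rw [mul_comm (Y a _)]
    exact integral_mul_eq_zero_of_degenerate P (by simpa only [mul_comm] using hint)
      (hdeg b hb i hib) (hdep a ha) (mod_cast hia)
  · obtain ⟨i, hia, hib⟩ := Finset.not_subset.1 hsub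
    exact integral_mul_eq_zero_of_degenerate P hint (hdeg a ha i hia) (hdep b hb) (mod_cast hib)

end Orthogonality

section MultilinearMaps

variable {B : Type*} [NormedAddCommGroup B] [NormedSpace ℝ B] {ι : Type*} [DecidableEq ι]

theorem multilinear_update_sub (T : ContinuousMultilinearMap ℝ (fun _ : ι => B) ℝ)
    (x : ι → B) (i : ι) (y b : B) :
    T (fun j => Function.update x i y j - b) =
      T.toContinuousLinearMap (fun j => x j - b) i (y - b) := by
  rw [ContinuousMultilinearMap.toContinuousLinearMap_apply]
  exact congrArg T (funext fun j => Function.apply_update (fun _ z => z - b) x i y j)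

theorem enorm_toContinuousLinearMap_le [Fintype ι]
    (T : ContinuousMultilinearMap ℝ (fun _ : ι => B) ℝ) (v : ι → B) (i : ι) :
    ‖T.toContinuousLinearMap v i‖ₑ ≤ ‖T‖ₑ * ∏ j ∈ Finset.univ.erase i, ‖v j‖ₑ := by
  simp only [enorm_eq_nnnorm, ← ENNReal.ofNNReal_finsetProd, ← ENNReal.coe_mul, ENNReal.coe_le_coe]
  refine ContinuousLinearMap.opNNNorm_le_bound _ _ fun y => (T.le_opNNNorm _).trans_eq ?_
  rw [← Finset.mul_prod_erase _ _ (Finset.mem_univ i), Function.update_self,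
    Finset.prod_congr rfl fun j hj => by rw [Function.update_of_ne (Finset.ne_of_mem_erase hj)]]
  ring

end MultilinearMaps

section MultilinearMoments

variable {B : Type*} [NormedAddCommGroup B] [NormedSpace ℝ B] [MeasurableSpace B] (P : Measure B)

theorem lintegral_enorm_dual_sq_le (u : StrongDual ℝ B) :
    ∫⁻ w, ‖u (w - mean P)‖ₑ ^ 2 ∂P ≤ ‖u‖ₑ ^ 2 * weakVar P := by
  rcases eq_or_ne u 0 with rfl | hu
  · simp
  have hu' : ‖u‖ ≠ 0 := norm_ne_zero_iff.2 hu
  have hnormalize : ∀ z, ‖u z‖ₑ ^ 2 = ‖u‖ₑ ^ 2 * ‖(‖u‖⁻¹ • u) z‖ₑ ^ 2 := by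
    intro z
    rw [← mul_pow, ← enorm_norm u, ← enorm_mul, smul_apply, smul_eq_mul, mul_inv_cancel_left₀ hu']
  simp_rw [hnormalize]
  rw [lintegral_const_mul' _ _ (by simp)]
  gcongr
  exact le_iSup₂_of_le (‖u‖⁻¹ • u) (by rw [norm_smul]; simp [hu']) le_rfl

theorem integral_clm_sub_mean {F : Type*} [NormedAddCommGroup F] [NormedSpace ℝ F]
    [CompleteSpace F] [CompleteSpace B] [IsProbabilityMeasure P]
    (hP : Integrable (fun w : B => w) P) (u : B →L[ℝ] F) : ∫ w, u (w - mean P) ∂P = 0 := by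
  have hsub : Integrable (fun w => w - mean P) P := hP.sub (integrable_const _)
  rw [u.integral_comp_comm hsub, integral_sub hP (integrable_const _)]
  simp [mean]

variable [BorelSpace B] [SecondCountableTopology B] {ι : Type*}

theorem measurable_multilinear_sub [Finite ι]
    (T : ContinuousMultilinearMap ℝ (fun _ : ι => B) ℝ) (b : B) :
    Measurable fun x : ι → B => T fun i => x i - b :=
  (T.cont.comp (by fun_prop)).measurable

theorem lintegral_enorm_multilinear_sq_le [Fintype ι] [Nonempty ι] [IsProbabilityMeasure P]
    (T : ContinuousMultilinearMap ℝ (fun _ : ι => B) ℝ) :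
    ∫⁻ x, ‖T fun i => x i - mean P‖ₑ ^ 2 ∂Measure.pi (fun _ => P) ≤
      ‖T‖ₑ ^ 2 * (weakVar P * strongVar P ^ (Fintype.card ι - 1)) := by
  classical
  obtain ⟨i⟩ := ‹Nonempty ι›
  have hmeas : Measurable fun y : B => ‖y - mean P‖ₑ ^ 2 := by fun_prop
  rw [lintegral_pi_eq_lintegral_lintegral_update (fun _ => P) i
    ((measurable_multilinear_sub T (mean P)).enorm.pow_const 2)]
  calc _ ≤ ∫⁻ x : ι → B, ‖T‖ₑ ^ 2 * weakVar P *
        ∏ j ∈ Finset.univ.erase i, ‖x j - mean P‖ₑ ^ 2 ∂Measure.pi fun _ => P := by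
        refine lintegral_mono fun x => ?_
        simp only [multilinear_update_sub]
        refine (lintegral_enorm_dual_sq_le P _).trans ?_
        rw [Finset.prod_pow, mul_right_comm, ← mul_pow]
        gcongr
        exact enorm_toContinuousLinearMap_le T _ i
    _ = _ := by
        rw [lintegral_const_mul _ (by fun_prop), lintegral_pi_prod (fun _ => P) fun _ => hmeas,
          Finset.prod_const, Finset.card_erase_of_mem (Finset.mem_univ i), Finset.card_univ,
          strongVar, mul_assoc]

end MultilinearMoments

section UStatisticVariance

theorem enorm_inv_natCast {k : ℕ} (hk : k ≠ 0) : ‖(k : ℝ)⁻¹‖ₑ = (k : ℝ≥0∞)⁻¹ := by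
  rw [enorm_inv (Nat.cast_ne_zero.2 hk), Real.enorm_natCast]

theorem injOn_sigma_image_univ {n : ℕ} : Set.InjOn
    (fun p : (k : ℕ) × (Fin k → Fin n) => Finset.univ.image p.2) {p | StrictMono p.2} := by
  rintro ⟨k, J⟩ hJ ⟨l, K⟩ hK h
  obtain rfl : k = l := by
    simpa [Finset.card_image_of_injective _ hJ.injective,
      Finset.card_image_of_injective _ hK.injective] using congrArg Finset.card h
  have hrange : Set.range J = Set.range K := by
    simpa using congrArg (fun A : Finset (Fin n) => (A : Set (Fin n))) h
  exact congrArg _ ((StrictMono.range_inj hJ hK).1 hrange)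

theorem pow_le_factorial_mul_descFactorial {n k : ℕ} (hk : k ≤ n) :
    n ^ k ≤ k ! * n.descFactorial k := by
  induction k with
  | zero => simp
  | succ k ih =>
    have hstep : n ≤ (k + 1) * (n - k) := by
      obtain ⟨d, rfl⟩ := Nat.exists_eq_add_of_le hk
      rw [show k + 1 + d - k = d + 1 by omega]
      nlinarith
    calc n ^ (k + 1) = n * n ^ k := by ring
      _ ≤ ((k + 1) * (n - k)) * (k ! * n.descFactorial k) := Nat.mul_le_mul hstep (ih (by omega))
      _ = (k + 1)! * n.descFactorial (k + 1) := by
        rw [Nat.descFactorial_succ, Nat.factorial_succ]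
        ring

theorem inv_choose_mul_inv_factorial_sq_le {n k : ℕ} (hk : k ≤ n) :
    (n.choose k : ℝ≥0∞)⁻¹ * ((k ! : ℝ≥0∞)⁻¹) ^ 2 ≤ ((n : ℝ≥0∞)⁻¹) ^ k := by
  have hchoose := Nat.choose_pos hk
  rw [← ENNReal.inv_pow, ← ENNReal.inv_pow, ← ENNReal.mul_inv (by simp [hchoose.ne']) (by simp),
    ENNReal.inv_le_inv]
  have hpow := pow_le_factorial_mul_descFactorial hk
  rw [Nat.descFactorial_eq_factorial_mul_choose] at hpow
  calc (n : ℝ≥0∞) ^ k ≤ k ! * (k ! * n.choose k) := mod_cast hpow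
    _ = n.choose k * (k ! : ℝ≥0∞) ^ 2 := by ring

theorem card_filter_strictMono (n k : ℕ) [DecidablePred fun J : Fin k → Fin n => StrictMono J] :
    (Finset.univ.filter fun J : Fin k → Fin n => StrictMono J).card = n.choose k := by
  rw [Finset.card_eq_sum_ones, sum_strictMono_eq_sum_powersetCard fun _ => 1,
    ← Finset.card_eq_sum_ones, Finset.card_powersetCard, Finset.card_univ, Fintype.card_fin]

variable {B : Type*} [NormedAddCommGroup B] [NormedSpace ℝ B] [MeasurableSpace B] [BorelSpace B]
  [SecondCountableTopology B] (P : Measure B) [IsProbabilityMeasure P] {n : ℕ}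

theorem sum_lintegral_enorm_kernel_sq_le {k : ℕ}
    [DecidablePred fun J : Fin k → Fin n => StrictMono J]
    (T : ContinuousMultilinearMap ℝ (fun _ : Fin k => B) ℝ) (b : B) :
    ∑ J : Fin k → Fin n with StrictMono J,
        ∫⁻ w, ‖(n.choose k : ℝ)⁻¹ * T fun i => w (J i) - b‖ₑ ^ 2 ∂Measure.pi (fun _ => P) ≤
      (n.choose k : ℝ≥0∞)⁻¹ * ∫⁻ x, ‖T fun i => x i - b‖ₑ ^ 2 ∂Measure.pi (fun _ => P) := by
  rcases (n.choose k).eq_zero_or_pos with hchoose | hchoose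
  · simp [hchoose]
  have hC : ‖(n.choose k : ℝ)⁻¹‖ₑ = (n.choose k : ℝ≥0∞)⁻¹ := enorm_inv_natCast hchoose.ne'
  have hkernel : ∀ J ∈ Finset.univ.filter fun J : Fin k → Fin n => StrictMono J,
      ∫⁻ w, ‖(n.choose k : ℝ)⁻¹ * T fun i => w (J i) - b‖ₑ ^ 2 ∂Measure.pi (fun _ => P) =
        (n.choose k : ℝ≥0∞)⁻¹ ^ 2 *
          ∫⁻ x, ‖T fun i => x i - b‖ₑ ^ 2 ∂Measure.pi (fun _ => P) := by
    intro J hJ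
    have hmeas : Measurable fun x : Fin k → B => ‖T fun i => x i - b‖ₑ ^ 2 :=
      (measurable_multilinear_sub T b).enorm.pow_const 2
    rw [← (measurePreserving_pi_comp_of_injective (fun _ => P)
      (Finset.mem_filter.1 hJ).2.injective).lintegral_comp hmeas, ← hC]
    simp only [enorm_mul, mul_pow]
    rw [lintegral_const_mul' _ _ (by simp)]
  rw [Finset.sum_congr rfl hkernel, Finset.sum_const, card_filter_strictMono, nsmul_eq_mul,
    ← mul_assoc, sq, ← mul_assoc, ENNReal.mul_inv_cancel (by simp [hchoose.ne']) (by simp), one_mul]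

/-- A bound for the second moment of `(k!)⁻¹ T[Ū^{(k)}]`, the U-statistic being taken at the mean
of the sample distribution `P`, when the `k`-linear form `T` has norm one: it is `1` for `k = 0` and
`ν/n (V/n)^{k-1}` for `k ≥ 1`. -/
def uStatBound {B : Type*} [NormedAddCommGroup B] [NormedSpace ℝ B] [MeasurableSpace B]
    (P : Measure B) (n : ℕ) : ℕ → ℝ≥0∞
  | 0 => 1
  | k + 1 => weakVar P / n * (strongVar P / n) ^ k

theorem lintegral_enorm_multilinear_sq_le_uStatBound {k : ℕ} (hk : k ≤ n)
    (T : ContinuousMultilinearMap ℝ (fun _ : Fin k => B) ℝ) :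
    (n.choose k : ℝ≥0∞)⁻¹ * (((k ! : ℝ≥0∞)⁻¹) ^ 2 *
        ∫⁻ x, ‖T fun i => x i - mean P‖ₑ ^ 2 ∂Measure.pi (fun _ => P)) ≤
      ‖T‖ₑ ^ 2 * uStatBound P n k := by
  cases k with
  | zero => simp [uStatBound]
  | succ k =>
    have hmoment := lintegral_enorm_multilinear_sq_le P T
    rw [Fintype.card_fin, Nat.add_sub_cancel] at hmoment
    calc _ ≤ ((n : ℝ≥0∞)⁻¹) ^ (k + 1) * (‖T‖ₑ ^ 2 * (weakVar P * strongVar P ^ k)) := by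
          rw [← mul_assoc]
          gcongr
          exact inv_choose_mul_inv_factorial_sq_le hk
      _ = _ := by
          simp only [uStatBound, div_eq_mul_inv]
          ring

variable [CompleteSpace B] {S : Finset ℕ}

theorem lintegral_enorm_sum_uStat_sq_le (hP : Integrable (fun w : B => w) P)
    (T : ∀ k, ContinuousMultilinearMap ℝ (fun _ : Fin k => B) ℝ) :
    ∫⁻ w : Fin n → B, ‖∑ k ∈ S, uStat w (mean P) (T k)‖ₑ ^ 2 ∂Measure.pi (fun _ => P) ≤
      ∑ k ∈ S, (n.choose k : ℝ≥0∞)⁻¹ *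
        ∫⁻ x, ‖T k fun i => x i - mean P‖ₑ ^ 2 ∂Measure.pi (fun _ => P) := by
  classical
  let Y : (k : ℕ) × (Fin k → Fin n) → (Fin n → B) → ℝ := fun p w =>
    (n.choose p.1 : ℝ)⁻¹ * T p.1 fun i => w (p.2 i) - mean P
  let I := S.sigma fun k => Finset.univ.filter fun J : Fin k → Fin n => StrictMono J
  have hmono : ∀ p ∈ I, StrictMono p.2 := fun p hp => by simpa using (Finset.mem_sigma.1 hp).2
  have hsum : ∀ w : Fin n → B, ∑ k ∈ S, uStat w (mean P) (T k) = ∑ p ∈ I, Y p w := by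
    intro w
    rw [Finset.sum_sigma]
    refine Finset.sum_congr rfl fun k _ => ?_
    rw [uStat, Finset.mul_sum]
  have hmeas : ∀ p ∈ I, Measurable (Y p) := fun p _ =>
    ((measurable_multilinear_sub (T p.1) (mean P)).comp (g := fun x : Fin p.1 → B => _)
      (by fun_prop : Measurable fun (w : Fin n → B) i => w (p.2 i))).const_mul _
  have hdep : ∀ p ∈ I, DependsOn (Y p) (Finset.univ.image p.2 : Finset (Fin n)) := by
    intro p _ x y hxy
    have : ∀ i, x (p.2 i) = y (p.2 i) := fun i => hxy _ (by simp)
    simp only [Y, this]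
  have hdeg : ∀ p ∈ I, ∀ i ∈ Finset.univ.image p.2, ∀ x : Fin n → B,
      ∫ y, Y p (Function.update x i y) ∂P = 0 := by
    intro p hp i hi x
    obtain ⟨a, -, rfl⟩ := Finset.mem_image.1 hi
    simp only [Y, Function.update_apply_of_injective x (hmono p hp).injective,
      multilinear_update_sub, integral_const_mul, integral_clm_sub_mean P hP, mul_zero]
  simp_rw [hsum]
  refine (lintegral_enorm_sum_sq_le_of_degenerate (fun _ => P)
    (injOn_sigma_image_univ.mono hmono) hmeas hdep hdeg).trans ?_
  rw [Finset.sum_sigma]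
  exact Finset.sum_le_sum fun k _ => sum_lintegral_enorm_kernel_sq_le P (T k) _

theorem lintegral_enorm_sum_inv_factorial_mul_uStat_sq_le (hP : Integrable (fun w : B => w) P)
    (hS : ∀ k ∈ S, k ≤ n) (T : ∀ k, ContinuousMultilinearMap ℝ (fun _ : Fin k => B) ℝ) :
    ∫⁻ w : Fin n → B, ‖∑ k ∈ S, (k ! : ℝ)⁻¹ * uStat w (mean P) (T k)‖ₑ ^ 2
        ∂Measure.pi (fun _ => P) ≤
      ∑ k ∈ S, ‖T k‖ₑ ^ 2 * uStatBound P n k := by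
  have hsmul : ∀ (w : Fin n → B) k,
      (k ! : ℝ)⁻¹ * uStat w (mean P) (T k) = uStat w (mean P) ((k ! : ℝ)⁻¹ • T k) :=
    fun w k => ((isLinearMap_uStat w (mean P)).map_smul _ _).symm
  simp_rw [hsmul]
  refine (lintegral_enorm_sum_uStat_sq_le P hP fun k => (k ! : ℝ)⁻¹ • T k).trans
    (Finset.sum_le_sum fun k hk => ?_)
  have hfact : ‖(k ! : ℝ)⁻¹‖ₑ = (k ! : ℝ≥0∞)⁻¹ := enorm_inv_natCast k.factorial_ne_zero
  simp only [smul_apply, enorm_smul, mul_pow, hfact]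
  rw [lintegral_const_mul' _ _ (by simp [Nat.factorial_ne_zero])]
  exact lintegral_enorm_multilinear_sq_le_uStatBound P (hS k hk) (T k)

end UStatisticVariance

section PilotRemainder

theorem sum_range_inv_factorial_le_exp_one (s : ℕ) :
    ∑ k ∈ Finset.range s, (k ! : ℝ≥0∞)⁻¹ ≤ ENNReal.ofReal (Real.exp 1) := by
  have hterm : ∀ k : ℕ, (k ! : ℝ≥0∞)⁻¹ = ENNReal.ofReal ((1 : ℝ) ^ k / k !) := by
    intro k
    rw [one_pow, one_div, ENNReal.ofReal_inv_of_pos (by positivity), ENNReal.ofReal_natCast]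
  rw [Finset.sum_congr rfl fun k _ => hterm k,
    ← ENNReal.ofReal_sum_of_nonneg fun k _ => by positivity]
  exact ENNReal.ofReal_le_ofReal (Real.sum_le_exp_of_nonneg zero_le_one s)

theorem inv_factorial_le_one (k : ℕ) : (k ! : ℝ≥0∞)⁻¹ ≤ 1 :=
  ENNReal.inv_le_one.2 (mod_cast k.factorial_pos)

theorem rpow_sq_mul_pow_le_max_rpow (r v : ℝ≥0∞) {a : ℝ} (ha : 0 ≤ a) (k : ℕ) :
    (r ^ a) ^ 2 * v ^ k ≤ max (r ^ 2) v ^ (a + k) := by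
  rw [ENNReal.rpow_add_of_nonneg _ _ ha k.cast_nonneg, ENNReal.rpow_natCast,
    ← ENNReal.rpow_mul_natCast, mul_comm a, ENNReal.rpow_natCast_mul]
  gcongr
  exacts [le_max_left _ _, le_max_right _ _]

variable {B : Type*} [NormedAddCommGroup B] [NormedSpace ℝ B] [MeasurableSpace B] (P : Measure B)
  {s : ℕ} {m ρ : ℝ}

theorem sq_mul_uStatBound_succ_le (n : ℕ) (hρ : 0 ≤ ρ) (hm : m = s + ρ) {j : ℕ} (hjs : j + 1 ≤ s)
    {a L r : ℝ≥0∞}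
    (ha : a ≤ ((s - (j + 1))! : ℝ≥0∞)⁻¹ * (L * r ^ (((s - (j + 1) : ℕ) : ℝ) + ρ))) :
    a ^ 2 * uStatBound P n (j + 1) ≤ ((s - (j + 1))! : ℝ≥0∞)⁻¹ *
      (L ^ 2 * (weakVar P / n * max (r ^ 2) (strongVar P / n) ^ (m - 1))) := by
  have hexponent : m - 1 = ((s - (j + 1) : ℕ) : ℝ) + ρ + j := by
    rw [Nat.cast_sub hjs, hm]
    push_cast
    ring
  rw [hexponent]
  set c := ((s - (j + 1))! : ℝ≥0∞)⁻¹
  set q := ((s - (j + 1) : ℕ) : ℝ) + ρ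
  calc a ^ 2 * uStatBound P n (j + 1)
      ≤ (c * (L * r ^ q)) ^ 2 * (weakVar P / n * (strongVar P / n) ^ j) := by
        gcongr
        exact le_rfl
    _ = c * c * (L ^ 2 * (weakVar P / n * ((r ^ q) ^ 2 * (strongVar P / n) ^ j))) := by ring
    _ ≤ c * 1 * (L ^ 2 * (weakVar P / n * max (r ^ 2) (strongVar P / n) ^ (q + j))) := by
        gcongr
        exacts [inv_factorial_le_one _, rpow_sq_mul_pow_le_max_rpow _ _ (by positivity) _]
    _ = _ := by rw [mul_one]

theorem sum_sq_mul_uStatBound_le (n : ℕ) (hρ : 0 ≤ ρ) (hm : m = s + ρ) {a : ℕ → ℝ≥0∞}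
    {L r : ℝ≥0∞} (ha : ∀ j ≤ s, a j ≤ ((s - j)! : ℝ≥0∞)⁻¹ * (L * r ^ (((s - j : ℕ) : ℝ) + ρ))) :
    ∑ j ∈ Finset.range (s + 1), a j ^ 2 * uStatBound P n j ≤
      L ^ 2 * (r ^ (2 * m) + if 1 ≤ s then ENNReal.ofReal (Real.exp 1) * weakVar P / n *
        max (r ^ 2) (strongVar P / n) ^ (m - 1) else 0) := by
  have hzero : a 0 ^ 2 ≤ L ^ 2 * r ^ (2 * m) := by
    calc a 0 ^ 2 ≤ (1 * (L * r ^ m)) ^ 2 := by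
          gcongr
          rw [hm]
          exact (ha 0 s.zero_le).trans (mul_le_mul_left (inv_factorial_le_one s) _)
      _ = L ^ 2 * r ^ (2 * m) := by
          rw [one_mul, mul_pow, ← ENNReal.rpow_mul_natCast, mul_comm m, Nat.cast_ofNat]
  have hsucc : ∀ j ∈ Finset.range s, a (j + 1) ^ 2 * uStatBound P n (j + 1) ≤
      ((s - 1 - j)! : ℝ≥0∞)⁻¹ *
        (L ^ 2 * (weakVar P / n * max (r ^ 2) (strongVar P / n) ^ (m - 1))) := by
    intro j hj
    have hjs : j + 1 ≤ s := Finset.mem_range.1 hj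
    rw [Nat.sub_sub, add_comm 1 j]
    exact sq_mul_uStatBound_succ_le P n hρ hm hjs (ha _ hjs)
  rw [Finset.sum_range_succ', add_comm, mul_add]
  refine add_le_add (by simpa only [uStatBound, mul_one] using hzero) ?_
  split_ifs with hs
  · refine (Finset.sum_le_sum hsucc).trans ?_
    rw [← Finset.sum_mul, Finset.sum_range_reflect fun k => (k ! : ℝ≥0∞)⁻¹, mul_left_comm,
      mul_div_assoc, mul_assoc]
    gcongr
    exact sum_range_inv_factorial_le_exp_one s
  · simp [show s = 0 by omega]

variable [BorelSpace B] [SecondCountableTopology B] [IsProbabilityMeasure P] [CompleteSpace B]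
  {n : ℕ} {Θ : Set B} {f : B → ℝ}

theorem lintegral_enorm_oneSided_sub_sq_le (hP : Integrable (fun w : B => w) P) (hΘ : IsOpen Θ)
    (hmean : mean P ∈ Θ) (hρ : 0 < ρ) (hm : m = s + ρ) (hf : ContDiffOn ℝ s f Θ) (hsn : s ≤ n)
    {t : B} (ht : t ∈ Θ) (hseg : 1 ≤ s → segment ℝ (mean P) t ⊆ Θ) :
    ∫⁻ w : Fin n → B, ‖oneSided f s w t - oneSided f s w (mean P)‖ₑ ^ 2
        ∂Measure.pi (fun _ => P) ≤
      lipSeminorm ρ Θ (iteratedFDeriv ℝ s f) ^ 2 * (‖t - mean P‖ₑ ^ (2 * m) +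
        if 1 ≤ s then ENNReal.ofReal (Real.exp 1) * weakVar P / n *
          max (‖t - mean P‖ₑ ^ 2) (strongVar P / n) ^ (m - 1) else 0) := by
  simp_rw [oneSided_sub_oneSided (hf.contDiffAt (hΘ.mem_nhds ht)) hsn]
  refine (lintegral_enorm_sum_inv_factorial_mul_uStat_sq_le P hP
    (fun j hj => (Finset.mem_range_succ_iff.1 hj).trans hsn) _).trans ?_
  exact sum_sq_mul_uStatBound_le P n hρ.le hm fun j hj =>
    enorm_taylorPoly_sub_iteratedFDeriv_le hΘ hf hρ ht hmean hseg hj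

end PilotRemainder

section RootMean

variable {Ω : Type*} [MeasurableSpace Ω] {μ : Measure Ω}

theorem rootMean_eq_sqrtE (X : Ω → ℝ≥0∞) : rootMean μ X = sqrtE (∫⁻ ω, X ω ∂μ) := rfl

theorem rootMean_enorm_sq_eq_eLpNorm (g : Ω → ℝ) :
    rootMean μ (fun ω => ‖g ω‖ₑ ^ 2) = eLpNorm g 2 μ := by
  simp [eLpNorm_eq_lintegral_rpow_enorm_toReal, rootMean]

theorem sqrtE_mono {a b : ℝ≥0∞} (h : a ≤ b) : sqrtE a ≤ sqrtE b :=
  ENNReal.rpow_le_rpow h (by norm_num)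

theorem one_le_sqrtE {a : ℝ≥0∞} (h : 1 ≤ a) : 1 ≤ sqrtE a :=
  ENNReal.one_le_rpow h (by norm_num)

theorem sqrtE_mul (a b : ℝ≥0∞) : sqrtE (a * b) = sqrtE a * sqrtE b :=
  ENNReal.mul_rpow_of_nonneg _ _ (by norm_num)

theorem sqrtE_pow (a : ℝ≥0∞) (k : ℕ) : sqrtE (a ^ k) = sqrtE a ^ k := by
  rw [sqrtE, sqrtE, ← ENNReal.rpow_natCast_mul, mul_comm, ENNReal.rpow_mul_natCast]

theorem sqrtE_sq (a : ℝ≥0∞) : sqrtE (a ^ 2) = a := by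
  rw [sqrtE, ← ENNReal.rpow_natCast_mul]
  norm_num

theorem sqrtE_add_le (a b : ℝ≥0∞) : sqrtE (a + b) ≤ sqrtE a + sqrtE b :=
  ENNReal.rpow_add_le_add_rpow _ _ (by norm_num) (by norm_num)

theorem sqrtE_sum_le {κ : Type*} (S : Finset κ) (a : κ → ℝ≥0∞) :
    sqrtE (∑ k ∈ S, a k) ≤ ∑ k ∈ S, sqrtE (a k) :=
  Finset.le_sum_of_subadditive sqrtE (by simp [sqrtE]) sqrtE_add_le S a

theorem rootMean_enorm_add_sq_le {g h : Ω → ℝ} (hg : AEMeasurable g μ) (hh : AEMeasurable h μ) :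
    rootMean μ (fun ω => ‖g ω + h ω‖ₑ ^ 2) ≤
      rootMean μ (fun ω => ‖g ω‖ₑ ^ 2) + rootMean μ (fun ω => ‖h ω‖ₑ ^ 2) := by
  simp only [rootMean_enorm_sq_eq_eLpNorm]
  exact eLpNorm_add_le hg.aestronglyMeasurable hh.aestronglyMeasurable one_le_two

theorem rootMean_enorm_average_sq_le {g h : Ω → ℝ} {b : ℝ≥0∞} (hg : AEMeasurable g μ)
    (hh : AEMeasurable h μ) (hgb : rootMean μ (fun ω => ‖g ω‖ₑ ^ 2) ≤ b)
    (hhb : rootMean μ (fun ω => ‖h ω‖ₑ ^ 2) ≤ b) :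
    rootMean μ (fun ω => ‖(1 / 2 : ℝ) * (g ω + h ω)‖ₑ ^ 2) ≤ b := by
  calc rootMean μ (fun ω => ‖(1 / 2 : ℝ) * (g ω + h ω)‖ₑ ^ 2)
      = ‖(1 / 2 : ℝ)‖ₑ * rootMean μ (fun ω => ‖g ω + h ω‖ₑ ^ 2) := by
        simp only [rootMean_enorm_sq_eq_eLpNorm]
        exact eLpNorm_const_smul (1 / 2 : ℝ) (fun ω => g ω + h ω) 2 μ
    _ ≤ ‖(1 / 2 : ℝ)‖ₑ * (b + b) := by
        gcongr
        exact (rootMean_enorm_add_sq_le hg hh).trans (add_le_add hgb hhb)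
    _ = b := by
        rw [one_div, enorm_inv two_ne_zero, ← two_mul, ← mul_assoc]
        simp [enorm_eq_nnnorm, ENNReal.inv_mul_cancel]

theorem rootMean_ofReal_natCast_mul_sq (N : ℕ) (g : Ω → ℝ) :
    rootMean μ (fun ω => ENNReal.ofReal (N * g ω ^ 2)) =
      sqrtE N * rootMean μ (fun ω => ‖g ω‖ₑ ^ 2) := by
  have hscale : ∀ x : ℝ, ENNReal.ofReal (N * x ^ 2) = N * ‖x‖ₑ ^ 2 := by
    intro x
    rw [ENNReal.ofReal_mul N.cast_nonneg, ENNReal.ofReal_natCast, ← sq_abs,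
      ENNReal.ofReal_pow (abs_nonneg x), ← Real.enorm_eq_ofReal_abs]
  simp only [hscale, rootMean_eq_sqrtE]
  rw [lintegral_const_mul' _ _ (ENNReal.natCast_ne_top N), sqrtE_mul]

end RootMean

section Independence

variable {Ω : Type*} [MeasurableSpace Ω] {μ : Measure Ω}

theorem lintegral_comp_eq_of_indepFun [IsFiniteMeasure μ] {E F : Type*} [MeasurableSpace E]
    [MeasurableSpace F] {Z : Ω → E} {τ : Ω → F} (hZ : AEMeasurable Z μ) (hτ : AEMeasurable τ μ)
    (hindep : IndepFun Z τ μ) {G : E × F → ℝ≥0∞}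
    (hG : AEMeasurable G (μ.map fun ω => (Z ω, τ ω))) :
    ∫⁻ ω, G (Z ω, τ ω) ∂μ = ∫⁻ ω, ∫⁻ z, G (z, τ ω) ∂μ.map Z ∂μ := by
  have hprod := hindep.map_prod_eq_prod_map_map hZ hτ
  rw [← lintegral_map' hG (hZ.prodMk hτ), hprod]
  rw [hprod] at hG
  rw [lintegral_prod_symm _ hG, lintegral_map' hG.lintegral_prod_left' hτ]

variable {E ι κ κ' : Type*} [MeasurableSpace E] {W : ι → Ω → E} [Finite κ] [Finite κ']

theorem indepFun_comp_of_disjoint (hW : ∀ i, Measurable (W i))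
    (hindep : iIndepFun W μ) {e : κ → ι} {e' : κ' → ι}
    (hdisj : Disjoint (Set.range e) (Set.range e')) :
    IndepFun (fun ω k => W (e k) ω) (fun ω k => W (e' k) ω) μ := by
  classical
  have := Fintype.ofFinite κ
  have := Fintype.ofFinite κ'
  have himages : Disjoint (Finset.univ.image e) (Finset.univ.image e') := by
    simpa [← Finset.disjoint_coe] using hdisj
  have hproj : Measurable fun (v : Finset.univ.image e → E) k => v ⟨e k, by simp⟩ := by fun_prop
  have hproj' : Measurable fun (v : Finset.univ.image e' → E) k => v ⟨e' k, by simp⟩ := by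
    fun_prop
  exact (hindep.indepFun_finset _ _ himages hW).comp hproj hproj'

variable {n : ℕ} {X : Fin (n + n) → Ω → E}

theorem disjoint_range_castAdd_range_natAdd (m n : ℕ) :
    Disjoint (Set.range (Fin.castAdd n : Fin m → Fin (m + n))) (Set.range (Fin.natAdd m)) := by
  rw [Set.disjoint_left]
  rintro _ ⟨i, rfl⟩ ⟨j, hj⟩
  have := congrArg Fin.val hj
  simp only [Fin.val_natAdd, Fin.val_castAdd] at this
  omega

theorem indepFun_half₁_half₂ (hX : ∀ i, Measurable (X i)) (hindep : iIndepFun X μ) :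
    IndepFun (fun ω => half₁ fun i => X i ω) (fun ω => half₂ fun i => X i ω) μ :=
  indepFun_comp_of_disjoint hX hindep (disjoint_range_castAdd_range_natAdd n n)

theorem hasLaw_half₁ {P : Measure E} [IsProbabilityMeasure P] (hX : ∀ i, Measurable (X i))
    (hlaw : ∀ i, μ.map (X i) = P) (hindep : iIndepFun X μ) :
    HasLaw (fun ω => half₁ fun i => X i ω) (Measure.pi fun _ => P) μ :=
  (hindep.precomp (Fin.castAdd_injective n n)).hasLaw_pi fun _ => ⟨(hX _).aemeasurable, hlaw _⟩

theorem hasLaw_half₂ {P : Measure E} [IsProbabilityMeasure P] (hX : ∀ i, Measurable (X i))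
    (hlaw : ∀ i, μ.map (X i) = P) (hindep : iIndepFun X μ) :
    HasLaw (fun ω => half₂ fun i => X i ω) (Measure.pi fun _ => P) μ :=
  (hindep.precomp (Fin.natAdd_injective n n)).hasLaw_pi fun _ => ⟨(hX _).aemeasurable, hlaw _⟩

end Independence

section OneSidedError

variable {B : Type*} [NormedAddCommGroup B] [NormedSpace ℝ B] {f : B → ℝ} {s n : ℕ} {Θ : Set B}

/-- The terms of degrees `k ∈ S` of the one-sided estimator with pilot value `t`. -/
def expansionSum (f : B → ℝ) (S : Finset ℕ) (w : Fin n → B) (t : B) : ℝ :=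
  ∑ k ∈ S, (k ! : ℝ)⁻¹ * uStat w t (iteratedFDeriv ℝ k f t)

/-- The error of the one-sided estimator after recentering at `θ`, with only the terms of degrees
`k ∈ S` of the expansion at `θ` kept: for `S = {1, …, s}` this is `oneSided f s w t - f θ`. -/
def oneSidedError (f : B → ℝ) (s : ℕ) (S : Finset ℕ) (θ : B) (w : Fin n → B) (t : B) : ℝ :=
  oneSided f s w t - oneSided f s w θ + expansionSum f S w θ

theorem oneSided_eq_add_expansionSum (f : B → ℝ) (s : ℕ) (w : Fin n → B) (t : B) :
    oneSided f s w t = f t + expansionSum f (Finset.Icc 1 s) w t := rfl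

theorem continuous_expansionSum (f : B → ℝ) (S : Finset ℕ) (t : B) :
    Continuous fun w : Fin n → B => expansionSum f S w t := by
  unfold expansionSum uStat
  exact continuous_finsetSum _ fun k _ => continuous_const.mul (continuous_const.mul
    (continuous_finsetSum _ fun J _ => (iteratedFDeriv ℝ k f t).cont.comp (by fun_prop)))

theorem continuous_oneSided (f : B → ℝ) (s : ℕ) (t : B) :
    Continuous fun w : Fin n → B => oneSided f s w t :=
  continuous_const.add (continuous_expansionSum f _ t)

theorem continuousOn_oneSided (hΘ : IsOpen Θ) (hf : ContDiffOn ℝ s f Θ) :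
    ContinuousOn (fun p : (Fin n → B) × B => oneSided f s p.1 p.2) (Set.univ ×ˢ Θ) := by
  have hsnd : Set.MapsTo (Prod.snd : (Fin n → B) × B → B) (Set.univ ×ˢ Θ) Θ := fun p hp => hp.2
  have hderiv : ∀ k ≤ s, ContinuousOn (iteratedFDeriv ℝ k f) Θ := fun k hk =>
    (hf.continuousOn_iteratedFDerivWithin (mod_cast hk) hΘ.uniqueDiffOn).congr
      fun x hx => (iteratedFDerivWithin_of_isOpen k hΘ hx).symm
  unfold oneSided uStat
  refine (hf.continuousOn.comp continuousOn_snd hsnd).add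
    (continuousOn_finsetSum _ fun k hk => continuousOn_const.mul (continuousOn_const.mul
      (continuousOn_finsetSum _ fun J _ => ?_)))
  exact ((hderiv k (Finset.mem_Icc.1 hk).2).comp continuousOn_snd hsnd).eval
    (Continuous.continuousOn (by fun_prop))

theorem isOpen_setOf_segment_subset (hΘ : IsOpen Θ) (θ : B) :
    IsOpen {t | segment ℝ θ t ⊆ Θ} := by
  have hset : {t | segment ℝ θ t ⊆ Θ} = {t | ∀ r ∈ Set.Icc (0 : ℝ) 1, θ + r • (t - θ) ∈ Θ} := by
    ext t
    rw [Set.mem_ofPred_eq, segment_eq_image', Set.image_subset_iff]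
    rfl
  rw [hset, isOpen_iff_eventually]
  intro t ht
  refine isCompact_Icc.eventually_forall_of_forall_eventually fun r hr => ?_
  have hcont : Continuous fun z : B × ℝ => θ + z.2 • (z.1 - θ) := by fun_prop
  exact hcont.continuousAt.eventually (hΘ.mem_nhds (ht r hr))

/-- The bound for the root mean square error of an estimator built from samples of size `n` and the
pilot `τ`, where `S` is the set of degrees of the U-statistics at the mean that contribute to the
error. -/
def crossFitBound {Ω : Type*} [MeasurableSpace B] [MeasurableSpace Ω] (P : Measure B) (f : B → ℝ)
    (s n : ℕ) (Θ : Set B) (m ρ : ℝ) (μ : Measure Ω) (τ : Ω → B) (S : Finset ℕ) : ℝ≥0∞ :=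
  lipSeminorm ρ Θ (iteratedFDeriv ℝ s f) * rootMean μ (fun ω => ‖τ ω - mean P‖ₑ ^ (2 * m)) +
    sqrtE (weakVar P / n) *
      ∑ k ∈ S, ‖iteratedFDeriv ℝ k f (mean P)‖ₑ * sqrtE (strongVar P / n) ^ (k - 1) +
    if 1 ≤ s then sqrtE (ENNReal.ofReal (Real.exp 1) * weakVar P / n) *
      lipSeminorm ρ Θ (iteratedFDeriv ℝ s f) *
        rootMean μ (fun ω => max (‖τ ω - mean P‖ₑ ^ 2) (strongVar P / n) ^ (m - 1))
    else 0

variable [MeasurableSpace B] [BorelSpace B] [SecondCountableTopology B] {P : Measure B}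

theorem aemeasurable_oneSided (hΘ : IsOpen Θ) (hf : ContDiffOn ℝ s f Θ)
    {Q : Measure ((Fin n → B) × B)} (hQ : ∀ᵐ p ∂Q, p.2 ∈ Θ) :
    AEMeasurable (fun p => oneSided f s p.1 p.2) Q := by
  have hmeas := (continuousOn_oneSided (n := n) hΘ hf).aemeasurable (μ := Q)
    (MeasurableSet.univ.prod hΘ.measurableSet)
  rwa [Measure.restrict_eq_self_of_ae_mem (by simpa using hQ)] at hmeas

variable {Ω : Type*} [MeasurableSpace Ω] {μ : Measure Ω} {Z : Ω → Fin n → B} {τ : Ω → B}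

theorem crossFitBound_eq_of_identDistrib {Ω' : Type*} [MeasurableSpace Ω'] {μ' : Measure Ω'}
    {τ' : Ω' → B} (h : IdentDistrib τ τ' μ μ') (m ρ : ℝ) (S : Finset ℕ) :
    crossFitBound P f s n Θ m ρ μ τ S = crossFitBound P f s n Θ m ρ μ' τ' S := by
  have hpow : Measurable fun t : B => ‖t - mean P‖ₑ ^ (2 * m) := by fun_prop
  have hmax : Measurable fun t : B =>
    max (‖t - mean P‖ₑ ^ 2) (strongVar P / n) ^ (m - 1) := by fun_prop
  have hpow_eq := (h.comp hpow).lintegral_eq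
  have hmax_eq := (h.comp hmax).lintegral_eq
  simp only [Function.comp_def] at hpow_eq hmax_eq
  simp only [crossFitBound, rootMean, hpow_eq, hmax_eq]

theorem aemeasurable_oneSided_map (hΘ : IsOpen Θ) (hf : ContDiffOn ℝ s f Θ)
    (hZ : AEMeasurable Z μ) (hτ : AEMeasurable τ μ) (hτΘ : ∀ᵐ ω ∂μ, τ ω ∈ Θ) :
    AEMeasurable (fun p => oneSided f s p.1 p.2) (μ.map fun ω => (Z ω, τ ω)) :=
  aemeasurable_oneSided hΘ hf
    ((ae_map_iff (hZ.prodMk hτ) (measurable_snd hΘ.measurableSet)).2 hτΘ)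

theorem aemeasurable_oneSidedError (hΘ : IsOpen Θ) (hf : ContDiffOn ℝ s f Θ)
    (hZ : AEMeasurable Z μ) (hτ : AEMeasurable τ μ) (hτΘ : ∀ᵐ ω ∂μ, τ ω ∈ Θ) (S : Finset ℕ)
    (θ : B) : AEMeasurable (fun ω => oneSidedError f s S θ (Z ω) (τ ω)) μ :=
  (((aemeasurable_oneSided_map hΘ hf hZ hτ hτΘ).comp_aemeasurable (hZ.prodMk hτ)).sub
    ((continuous_oneSided f s θ).measurable.comp_aemeasurable hZ)).add
    ((continuous_expansionSum f S θ).measurable.comp_aemeasurable hZ)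

variable [CompleteSpace B] [IsProbabilityMeasure P]

theorem rootMean_expansionSum_le (hP : Integrable (fun w : B => w) P)
    (hZ : HasLaw Z (Measure.pi fun _ => P) μ) (f : B → ℝ) {S : Finset ℕ}
    (hS : ∀ k ∈ S, 1 ≤ k ∧ k ≤ n) :
    rootMean μ (fun ω => ‖expansionSum f S (Z ω) (mean P)‖ₑ ^ 2) ≤
      sqrtE (weakVar P / n) *
        ∑ k ∈ S, ‖iteratedFDeriv ℝ k f (mean P)‖ₑ * sqrtE (strongVar P / n) ^ (k - 1) := by
  have hmeas : Measurable fun w : Fin n → B => ‖expansionSum f S w (mean P)‖ₑ ^ 2 :=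
    (continuous_expansionSum f S (mean P)).measurable.enorm.pow_const 2
  rw [rootMean_eq_sqrtE, hZ.lintegral_comp hmeas.aemeasurable]
  refine (sqrtE_mono (lintegral_enorm_sum_inv_factorial_mul_uStat_sq_le P hP
    (fun k hk => (hS k hk).2) fun k => iteratedFDeriv ℝ k f (mean P))).trans ?_
  refine (sqrtE_sum_le _ _).trans_eq ?_
  rw [Finset.mul_sum]
  refine Finset.sum_congr rfl fun k hk => ?_
  obtain ⟨j, rfl⟩ := Nat.exists_eq_add_of_le' (hS k hk).1
  rw [uStatBound, sqrtE_mul, sqrtE_sq, sqrtE_mul, sqrtE_pow, Nat.add_sub_cancel, mul_left_comm]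

variable {m ρ : ℝ}

theorem lintegral_enorm_oneSided_sub_sq_le_of_indepFun [IsFiniteMeasure μ]
    (hP : Integrable (fun w : B => w) P) (hΘ : IsOpen Θ) (hmean : mean P ∈ Θ) (hρ : 0 < ρ)
    (hm : m = s + ρ) (hf : ContDiffOn ℝ s f Θ) (hsn : s ≤ n)
    (hZ : HasLaw Z (Measure.pi fun _ => P) μ) (hτ : AEMeasurable τ μ) (hindep : IndepFun Z τ μ)
    (hτΘ : ∀ᵐ ω ∂μ, τ ω ∈ Θ) (hseg : 1 ≤ s → ∀ᵐ ω ∂μ, segment ℝ (mean P) (τ ω) ⊆ Θ) :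
    ∫⁻ ω, ‖oneSided f s (Z ω) (τ ω) - oneSided f s (Z ω) (mean P)‖ₑ ^ 2 ∂μ ≤
      ∫⁻ ω, lipSeminorm ρ Θ (iteratedFDeriv ℝ s f) ^ 2 * (‖τ ω - mean P‖ₑ ^ (2 * m) +
        if 1 ≤ s then ENNReal.ofReal (Real.exp 1) * weakVar P / n *
          max (‖τ ω - mean P‖ₑ ^ 2) (strongVar P / n) ^ (m - 1) else 0) ∂μ := by
  have hmeas := (((aemeasurable_oneSided_map hΘ hf hZ.aemeasurable hτ hτΘ).sub
    ((continuous_oneSided f s (mean P)).measurable.comp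
      measurable_fst).aemeasurable).enorm.pow_const 2)
  refine (lintegral_comp_eq_of_indepFun hZ.aemeasurable hτ hindep hmeas).trans_le ?_
  rw [hZ.map_eq]
  refine lintegral_mono_ae ?_
  filter_upwards [hτΘ, Filter.eventually_imp_distrib_left.2 hseg] with ω ht hts
  exact lintegral_enorm_oneSided_sub_sq_le P hP hΘ hmean hρ hm hf hsn ht hts

theorem rootMean_oneSided_sub_le [IsFiniteMeasure μ] (hP : Integrable (fun w : B => w) P)
    (hΘ : IsOpen Θ) (hmean : mean P ∈ Θ) (hρ : 0 < ρ) (hm : m = s + ρ)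
    (hf : ContDiffOn ℝ s f Θ) (hsn : s ≤ n) (hZ : HasLaw Z (Measure.pi fun _ => P) μ)
    (hτ : AEMeasurable τ μ) (hindep : IndepFun Z τ μ) (hτΘ : ∀ᵐ ω ∂μ, τ ω ∈ Θ)
    (hseg : 1 ≤ s → ∀ᵐ ω ∂μ, segment ℝ (mean P) (τ ω) ⊆ Θ) :
    rootMean μ (fun ω => ‖oneSided f s (Z ω) (τ ω) - oneSided f s (Z ω) (mean P)‖ₑ ^ 2) ≤
      lipSeminorm ρ Θ (iteratedFDeriv ℝ s f) *
          rootMean μ (fun ω => ‖τ ω - mean P‖ₑ ^ (2 * m)) +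
        if 1 ≤ s then sqrtE (ENNReal.ofReal (Real.exp 1) * weakVar P / n) *
          lipSeminorm ρ Θ (iteratedFDeriv ℝ s f) *
            rootMean μ (fun ω => max (‖τ ω - mean P‖ₑ ^ 2) (strongVar P / n) ^ (m - 1))
        else 0 := by
  have hpow : AEMeasurable (fun ω => ‖τ ω - mean P‖ₑ ^ (2 * m)) μ := by fun_prop
  have hmax : AEMeasurable
      (fun ω => max (‖τ ω - mean P‖ₑ ^ 2) (strongVar P / n) ^ (m - 1)) μ := by fun_prop
  simp only [rootMean_eq_sqrtE]
  refine (sqrtE_mono (lintegral_enorm_oneSided_sub_sq_le_of_indepFun hP hΘ hmean hρ hm hf hsn hZ hτ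
    hindep hτΘ hseg)).trans ?_
  split_ifs
  · rw [lintegral_const_mul'' _ (by fun_prop), lintegral_add_left' hpow,
      lintegral_const_mul'' _ hmax, sqrtE_mul, sqrtE_sq]
    refine (mul_le_mul_right (sqrtE_add_le _ _) _).trans_eq ?_
    rw [mul_add, sqrtE_mul (_ / _), mul_left_comm, mul_assoc]
  · simp only [add_zero]
    rw [lintegral_const_mul'' _ hpow, sqrtE_mul, sqrtE_sq]

theorem rootMean_oneSidedError_le [IsFiniteMeasure μ] (hP : Integrable (fun w : B => w) P)
    (hΘ : IsOpen Θ) (hmean : mean P ∈ Θ) (hρ : 0 < ρ) (hm : m = s + ρ)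
    (hf : ContDiffOn ℝ s f Θ) (hsn : s ≤ n) (hZ : HasLaw Z (Measure.pi fun _ => P) μ)
    (hτ : AEMeasurable τ μ) (hindep : IndepFun Z τ μ) (hτΘ : ∀ᵐ ω ∂μ, τ ω ∈ Θ)
    (hseg : 1 ≤ s → ∀ᵐ ω ∂μ, segment ℝ (mean P) (τ ω) ⊆ Θ) {S : Finset ℕ}
    (hS : S ⊆ Finset.Icc 1 s) :
    rootMean μ (fun ω => ‖oneSidedError f s S (mean P) (Z ω) (τ ω)‖ₑ ^ 2) ≤
      crossFitBound P f s n Θ m ρ μ τ S := by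
  have hsub := ((aemeasurable_oneSided_map hΘ hf hZ.aemeasurable hτ hτΘ).comp_aemeasurable
    (hZ.aemeasurable.prodMk hτ)).sub
    ((continuous_oneSided f s (mean P)).measurable.comp_aemeasurable hZ.aemeasurable)
  have hsum := (continuous_expansionSum f S (mean P)).measurable.comp_aemeasurable hZ.aemeasurable
  refine (rootMean_enorm_add_sq_le hsub hsum).trans ?_
  rw [crossFitBound, add_right_comm]
  refine add_le_add (rootMean_oneSided_sub_le hP hΘ hmean hρ hm hf hsn hZ hτ hindep hτΘ hseg)
    (rootMean_expansionSum_le hP hZ f fun k hk => ?_)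
  obtain ⟨hk, hks⟩ := Finset.mem_Icc.1 (hS hk)
  exact ⟨hk, hks.trans hsn⟩

end OneSidedError

section CrossFitError

variable {B : Type*} [NormedAddCommGroup B] [NormedSpace ℝ B] {f : B → ℝ} {s n : ℕ}

theorem expansionSum_singleton_one (f : B → ℝ) (w : Fin n → B) (θ : B) :
    expansionSum f {1} w θ = (n : ℝ)⁻¹ * ∑ i, fderiv ℝ f θ (w i - θ) := by
  rw [expansionSum, Finset.sum_singleton,
    uStat_eq_sum_powersetCard (Ψ := fun M => (M.map (fderiv ℝ f θ)).sum) fun v => by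
      simp [iteratedFDeriv_one_apply]]
  simp [Finset.powersetCard_one]

theorem fderiv_sampleMean_sub (hn : n ≠ 0) (f : B → ℝ) (w : Fin (n + n) → B) (θ : B) :
    fderiv ℝ f θ (sampleMean w - θ) =
      1 / 2 * (expansionSum f {1} (half₁ w) θ + expansionSum f {1} (half₂ w) θ) := by
  rw [expansionSum_singleton_one, expansionSum_singleton_one, sampleMean, Fin.sum_univ_add]
  simp only [map_sub, map_smul, map_add, map_sum, smul_eq_mul, Finset.sum_sub_distrib,
    Finset.sum_const, Finset.card_univ, Fintype.card_fin, nsmul_eq_mul, half₁, half₂]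
  push_cast
  field_simp
  ring

theorem crossFit_sub (f : B → ℝ) (s : ℕ) (T₁ T₂ : (Fin n → B) → B) (w : Fin (n + n) → B)
    (θ : B) :
    crossFit f s T₁ T₂ w - f θ =
      1 / 2 * (oneSidedError f s (Finset.Icc 1 s) θ (half₁ w) (T₂ (half₂ w)) +
        oneSidedError f s (Finset.Icc 1 s) θ (half₂ w) (T₁ (half₁ w))) := by
  simp only [crossFit, oneSidedError, oneSided_eq_add_expansionSum f s _ θ]
  ring

theorem crossFit_sub_sub_fderiv_sampleMean_sub (hs : 1 ≤ s) (hn : n ≠ 0) (f : B → ℝ)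
    (T₁ T₂ : (Fin n → B) → B) (w : Fin (n + n) → B) (θ : B) :
    crossFit f s T₁ T₂ w - f θ - fderiv ℝ f θ (sampleMean w - θ) =
      1 / 2 * (oneSidedError f s (Finset.Icc 2 s) θ (half₁ w) (T₂ (half₂ w)) +
        oneSidedError f s (Finset.Icc 2 s) θ (half₂ w) (T₁ (half₁ w))) := by
  have hsplit : ∀ v : Fin n → B, expansionSum f (Finset.Icc 1 s) v θ =
      expansionSum f {1} v θ + expansionSum f (Finset.Icc 2 s) v θ := by
    intro v
    rw [expansionSum, ← Finset.add_sum_Ioc_eq_sum_Icc hs, expansionSum, Finset.sum_singleton]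
    rfl
  rw [crossFit_sub, fderiv_sampleMean_sub hn]
  simp only [oneSidedError, hsplit]
  ring

variable [MeasurableSpace B] [BorelSpace B] {P : Measure B} {Ω : Type*}
  [MeasurableSpace Ω] {μ : Measure Ω} {W : Fin (n + n) → Ω → B}

variable [SecondCountableTopology B] [CompleteSpace B] [IsProbabilityMeasure P]
  [IsFiniteMeasure μ] {Θ : Set B} {m ρ : ℝ} {Ω' : Type*} [MeasurableSpace Ω'] {μ' : Measure Ω'}
  {Z : Ω → Fin n → B} {τ : Ω → B} {θn : Ω' → B}

theorem aemeasurable_and_rootMean_oneSidedError_le_of_identDistrib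
    (hP : Integrable (fun w : B => w) P) (hΘ : IsOpen Θ) (hmean : mean P ∈ Θ) (hρ : 0 < ρ)
    (hm : m = s + ρ) (hf : ContDiffOn ℝ s f Θ) (hsn : s ≤ n)
    (hZ : HasLaw Z (Measure.pi fun _ => P) μ) (hindep : IndepFun Z τ μ)
    (hτ : IdentDistrib τ θn μ μ') (hθΘ : ∀ᵐ ω ∂μ', θn ω ∈ Θ)
    (hseg : 1 ≤ s → ∀ᵐ ω ∂μ', segment ℝ (mean P) (θn ω) ⊆ Θ) {S : Finset ℕ}
    (hS : S ⊆ Finset.Icc 1 s) :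
    AEMeasurable (fun ω => oneSidedError f s S (mean P) (Z ω) (τ ω)) μ ∧
      rootMean μ (fun ω => ‖oneSidedError f s S (mean P) (Z ω) (τ ω)‖ₑ ^ 2) ≤
        crossFitBound P f s n Θ m ρ μ' θn S := by
  have hτΘ : ∀ᵐ ω ∂μ, τ ω ∈ Θ := hτ.symm.ae_mem_snd hΘ.measurableSet hθΘ
  have hτseg : 1 ≤ s → ∀ᵐ ω ∂μ, segment ℝ (mean P) (τ ω) ⊆ Θ := fun hs =>
    hτ.symm.ae_mem_snd (isOpen_setOf_segment_subset hΘ (mean P)).measurableSet (hseg hs)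
  refine ⟨aemeasurable_oneSidedError hΘ hf hZ.aemeasurable hτ.aemeasurable_fst hτΘ S (mean P), ?_⟩
  rw [← crossFitBound_eq_of_identDistrib hτ m ρ S]
  exact rootMean_oneSidedError_le hP hΘ hmean hρ hm hf hsn hZ hτ.aemeasurable_fst hindep hτΘ
    hτseg hS

theorem rootMean_crossFitError_le (hP : Integrable (fun w : B => w) P) (hΘ : IsOpen Θ)
    (hmean : mean P ∈ Θ) (hρ : 0 < ρ) (hm : m = s + ρ) (hf : ContDiffOn ℝ s f Θ) (hsn : s ≤ n)
    (hW : ∀ i, Measurable (W i)) (hlaw : ∀ i, μ.map (W i) = P) (hindep : iIndepFun W μ)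
    {T₁ T₂ : (Fin n → B) → B} (hT₁ : Measurable T₁) (hT₂ : Measurable T₂)
    (hθ₁ : IdentDistrib (fun ω => T₁ (half₁ fun i => W i ω)) θn μ μ')
    (hθ₂ : IdentDistrib (fun ω => T₂ (half₂ fun i => W i ω)) θn μ μ')
    (hθΘ : ∀ᵐ ω ∂μ', θn ω ∈ Θ)
    (hseg : 1 ≤ s → ∀ᵐ ω ∂μ', segment ℝ (mean P) (θn ω) ⊆ Θ) {S : Finset ℕ}
    (hS : S ⊆ Finset.Icc 1 s) :
    rootMean μ (fun ω => ‖(1 / 2 : ℝ) *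
        (oneSidedError f s S (mean P) (half₁ fun i => W i ω) (T₂ (half₂ fun i => W i ω)) +
          oneSidedError f s S (mean P) (half₂ fun i => W i ω) (T₁ (half₁ fun i => W i ω)))‖ₑ ^ 2) ≤
      crossFitBound P f s n Θ m ρ μ' θn S := by
  have hhalves := indepFun_half₁_half₂ hW hindep
  obtain ⟨hmeas₁, hle₁⟩ := aemeasurable_and_rootMean_oneSidedError_le_of_identDistrib hP hΘ hmean
    hρ hm hf hsn (hasLaw_half₁ hW hlaw hindep) (hhalves.comp measurable_id hT₂) hθ₂ hθΘ hseg hS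
  obtain ⟨hmeas₂, hle₂⟩ := aemeasurable_and_rootMean_oneSidedError_le_of_identDistrib hP hΘ hmean
    hρ hm hf hsn (hasLaw_half₂ hW hlaw hindep) (hhalves.symm.comp measurable_id hT₁) hθ₁ hθΘ hseg hS
  exact rootMean_enorm_average_sq_le hmeas₁ hmeas₂ hle₁ hle₂

end CrossFitError

section Constants

variable {B : Type*} [NormedAddCommGroup B] [NormedSpace ℝ B] [MeasurableSpace B]
  {Ω : Type*} [MeasurableSpace Ω] (P : Measure B) (f : B → ℝ) (s n : ℕ) (Θ : Set B) (m ρ : ℝ)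
  (μ : Measure Ω) (τ : Ω → B) (S : Finset ℕ)

theorem crossFitBound_le :
    crossFitBound P f s n Θ m ρ μ τ S ≤
      sqrtE 2 * lipSeminorm ρ Θ (iteratedFDeriv ℝ s f) *
          rootMean μ (fun ω => ‖τ ω - mean P‖ₑ ^ (2 * m)) +
        sqrtE (2 * weakVar P / n) *
          ∑ k ∈ S, ‖iteratedFDeriv ℝ k f (mean P)‖ₑ * sqrtE (strongVar P / n) ^ (k - 1) +
        if 1 ≤ s then sqrtE (2 * ENNReal.ofReal (Real.exp 1) * weakVar P / n) *
          lipSeminorm ρ Θ (iteratedFDeriv ℝ s f) *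
            rootMean μ (fun ω => max (‖τ ω - mean P‖ₑ ^ 2) (strongVar P / n) ^ (m - 1))
        else 0 := by
  have hdouble : ∀ a : ℝ≥0∞, sqrtE (a / n) ≤ sqrtE (2 * a / n) := fun a =>
    sqrtE_mono (ENNReal.div_le_div_right (le_mul_of_one_le_left' one_le_two) _)
  rw [crossFitBound, mul_assoc 2]
  gcongr
  · exact le_mul_of_one_le_left' (one_le_sqrtE one_le_two)
  · exact hdouble _
  · split_ifs
    · gcongr
      exact hdouble _
    · exact le_rfl

variable {n s}

theorem sqrtE_natCast_add_mul_sqrtE_div_le (hn : n ≠ 0) (a : ℝ≥0∞) :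
    sqrtE (n + n : ℕ) * sqrtE (a / n) ≤ sqrtE (4 * a) := by
  rw [← sqrtE_mul, ← two_mul, Nat.cast_mul, mul_assoc,
    ENNReal.mul_div_cancel (mod_cast hn) (ENNReal.natCast_ne_top n)]
  exact sqrtE_mono (mul_le_mul_left (by norm_num) a)

theorem sqrtE_mul_crossFitBound_le (hs : 1 ≤ s) (hn : n ≠ 0) :
    sqrtE (n + n : ℕ) * crossFitBound P f s n Θ m ρ μ τ S ≤
      sqrtE (4 * n) * lipSeminorm ρ Θ (iteratedFDeriv ℝ s f) *
          rootMean μ (fun ω => ‖τ ω - mean P‖ₑ ^ (2 * m)) +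
        sqrtE (4 * weakVar P) *
          ∑ k ∈ S, ‖iteratedFDeriv ℝ k f (mean P)‖ₑ * sqrtE (strongVar P / n) ^ (k - 1) +
        sqrtE (4 * ENNReal.ofReal (Real.exp 1) * weakVar P) *
          lipSeminorm ρ Θ (iteratedFDeriv ℝ s f) *
            rootMean μ (fun ω => max (‖τ ω - mean P‖ₑ ^ 2) (strongVar P / n) ^ (m - 1)) := by
  have hsize : sqrtE (n + n : ℕ) ≤ sqrtE (4 * n) := by
    rw [← two_mul, Nat.cast_mul]
    exact sqrtE_mono (mul_le_mul_left (by norm_num) _)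
  rw [crossFitBound, if_pos hs, mul_add, mul_add, mul_assoc 4]
  simp only [← mul_assoc (sqrtE (n + n : ℕ))]
  gcongr
  exacts [sqrtE_natCast_add_mul_sqrtE_div_le hn _, sqrtE_natCast_add_mul_sqrtE_div_le hn _]

end Constants

end CrossFit

end

theorem mainTheorem3_general
    {B : Type*} [NormedAddCommGroup B] [NormedSpace ℝ B] [CompleteSpace B]
    [TopologicalSpace.SeparableSpace B] [MeasurableSpace B] [BorelSpace B]
    {P : Measure B} [IsProbabilityMeasure P] (hP : Integrable (fun w : B => w) P)
    {Θ : Set B} (hΘ : IsOpen Θ) (hmean : CrossFit.mean P ∈ Θ)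
    {m ρ : ℝ} {s : ℕ} (hρ₀ : 0 < ρ) (hm : m = s + ρ) {f : B → ℝ} (hf : ContDiffOn ℝ s f Θ)
    {n : ℕ} (hsn : s ≤ n)
    {Ω : Type*} [MeasurableSpace Ω] {μ : Measure Ω} [IsProbabilityMeasure μ]
    {W : Fin (n + n) → Ω → B} (hW : ∀ i, Measurable (W i))
    (hlaw : ∀ i, μ.map (W i) = P) (hindep : iIndepFun W μ)
    {T₁ T₂ : (Fin n → B) → B} (hT₁ : Measurable T₁) (hT₂ : Measurable T₂)
    {Ω' : Type*} [MeasurableSpace Ω'] {μ' : Measure Ω'} {θn : Ω' → B}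
    (hθ₁ : IdentDistrib (fun ω => T₁ (CrossFit.half₁ fun i => W i ω)) θn μ μ')
    (hθ₂ : IdentDistrib (fun ω => T₂ (CrossFit.half₂ fun i => W i ω)) θn μ μ')
    (hθΘ : ∀ᵐ ω ∂μ', θn ω ∈ Θ)
    (hseg : 1 ≤ s → ∀ᵐ ω ∂μ', segment ℝ (CrossFit.mean P) (θn ω) ⊆ Θ) :
    CrossFit.rootMean μ (fun ω =>
        ‖CrossFit.crossFit f s T₁ T₂ (fun i => W i ω) - f (CrossFit.mean P)‖ₑ ^ 2) ≤
      CrossFit.crossFitBound P f s n Θ m ρ μ' θn (Finset.Icc 1 s) ∧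
    (1 ≤ s → CrossFit.rootMean μ (fun ω =>
        ‖CrossFit.crossFit f s T₁ T₂ (fun i => W i ω) - f (CrossFit.mean P) -
          fderiv ℝ f (CrossFit.mean P)
            (CrossFit.sampleMean (fun i => W i ω) - CrossFit.mean P)‖ₑ ^ 2) ≤
      CrossFit.crossFitBound P f s n Θ m ρ μ' θn (Finset.Icc 2 s)) := by
  have := UniformSpace.secondCountable_of_separable B
  have hbound := fun S => CrossFit.rootMean_crossFitError_le hP hΘ hmean hρ₀ hm hf hsn hW hlaw
    hindep hT₁ hT₂ hθ₁ hθ₂ hθΘ hseg (S := S)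
  refine ⟨?_, fun hs => ?_⟩
  · simp only [CrossFit.crossFit_sub]
    exact hbound _ subset_rfl
  · simp only [CrossFit.crossFit_sub_sub_fderiv_sampleMean_sub hs (by omega : n ≠ 0)]
    exact hbound _ (Finset.Icc_subset_Icc_left one_le_two)

theorem mainTheorem3
    {B : Type*} [NormedAddCommGroup B] [NormedSpace ℝ B] [CompleteSpace B]
    [TopologicalSpace.SeparableSpace B] [MeasurableSpace B] [BorelSpace B]
    -- the distribution and its mean, which lies in the open set `Θ`
    (P : Measure B) [IsProbabilityMeasure P] (hP : Integrable (fun w : B => w) P)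
    (Θ : Set B) (hΘ : IsOpen Θ) (hmean : CrossFit.mean P ∈ Θ)
    -- smoothness `m = s + ρ`, `s = ⌈m⌉ - 1`, `ρ ∈ (0, 1]`
    (m ρ : ℝ) (s : ℕ) (hρ₀ : 0 < ρ) (hρ₁ : ρ ≤ 1) (hm : m = s + ρ)
    (f : B → ℝ) (hf : ContDiffOn ℝ s f Θ)
    -- the sample `W₁, …, W_{2n}`, i.i.d. from `P`
    (n : ℕ) (hn : 1 ≤ n) (hsn : s ≤ n)
    {Ω : Type*} [MeasurableSpace Ω] (μ : Measure Ω) [IsProbabilityMeasure μ]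
    (W : Fin (n + n) → Ω → B) (hW : ∀ i, Measurable (W i))
    (hlaw : ∀ i, μ.map (W i) = P) (hindep : iIndepFun W μ)
    -- the pilot estimators of the two halves, with the common law of `θn`
    (T₁ T₂ : (Fin n → B) → B) (hT₁ : Measurable T₁) (hT₂ : Measurable T₂)
    {Ω' : Type*} [MeasurableSpace Ω'] (μ' : Measure Ω') (θn : Ω' → B)
    (hθ₁ : IdentDistrib (fun ω => T₁ (CrossFit.half₁ fun i => W i ω)) θn μ μ')
    (hθ₂ : IdentDistrib (fun ω => T₂ (CrossFit.half₂ fun i => W i ω)) θn μ μ')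
    (hθΘ : ∀ᵐ ω ∂μ', θn ω ∈ Θ)
    (hseg : 1 ≤ s → ∀ᵐ ω ∂μ', segment ℝ (CrossFit.mean P) (θn ω) ⊆ Θ) :
    let θ : B := CrossFit.mean P
    let ν : ℝ≥0∞ := CrossFit.weakVar P
    let V : ℝ≥0∞ := CrossFit.strongVar P
    let e : ℝ≥0∞ := ENNReal.ofReal (Real.exp 1)
    let L : ℝ≥0∞ := CrossFit.lipSeminorm ρ Θ (fun x => iteratedFDeriv ℝ s f x)
    let fhat : Ω → ℝ := fun ω => CrossFit.crossFit f s T₁ T₂ (fun i => W i ω)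
    CrossFit.rootMean μ (fun ω => ‖fhat ω - f θ‖ₑ ^ 2)
        ≤ CrossFit.sqrtE 2 * L * CrossFit.rootMean μ' (fun ω => ‖θn ω - θ‖ₑ ^ (2 * m))
          + CrossFit.sqrtE (2 * ν / n)
            * ∑ k ∈ Finset.Icc 1 s, ‖iteratedFDeriv ℝ k f θ‖ₑ * CrossFit.sqrtE (V / n) ^ (k - 1)
          + (if 1 ≤ s then
              CrossFit.sqrtE (2 * e * ν / n) * L
                * CrossFit.rootMean μ' (fun ω => max (‖θn ω - θ‖ₑ ^ 2) (V / n) ^ (m - 1))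
            else 0)
    ∧ (1 ≤ s →
      CrossFit.rootMean μ (fun ω => ENNReal.ofReal
          (((n + n : ℕ) : ℝ) *
            (fhat ω - f θ - fderiv ℝ f θ (CrossFit.sampleMean (fun i => W i ω) - θ)) ^ 2))
        ≤ CrossFit.sqrtE (4 * n) * L * CrossFit.rootMean μ' (fun ω => ‖θn ω - θ‖ₑ ^ (2 * m))
          + CrossFit.sqrtE (4 * ν)
            * ∑ k ∈ Finset.Icc 2 s, ‖iteratedFDeriv ℝ k f θ‖ₑ * CrossFit.sqrtE (V / n) ^ (k - 1)
          + CrossFit.sqrtE (4 * e * ν) * L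
            * CrossFit.rootMean μ' (fun ω => max (‖θn ω - θ‖ₑ ^ 2) (V / n) ^ (m - 1))) := by
  intro θ ν V e L fhat
  obtain ⟨herror, hlinearized⟩ := mainTheorem3_general hP hΘ hmean hρ₀ hm hf hsn hW hlaw hindep
    hT₁ hT₂ hθ₁ hθ₂ hθΘ hseg
  refine ⟨herror.trans (CrossFit.crossFitBound_le ..), fun hs => ?_⟩
  rw [CrossFit.rootMean_ofReal_natCast_mul_sq]
  exact (mul_le_mul_right (hlinearized hs) _).trans
    (CrossFit.sqrtE_mul_crossFitBound_le (hs := hs) (hn := by omega) ..)
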